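/- A \emph{stratified group} is a finite-dimensional real Lie algebra $V$ with a fixed decomposition $V=V_1\oplus\dots\oplus V_s$ such that $[V_i,V_j]\subset V_{i+j}$ and $[V_1,V_j]=V_{j+1}$ for all $i,j\ge 1$ (where $V_k=\{0\}$ for $k>s$) and $V_s\neq\{0\}$ (the trivial case $V=\{0\}$, $s=0$ being allowed), endowed with the group operation given by the Baker--Campbell--Hausdorff formula \[ pq=\sum_{n\ge 1}\frac{(-1)^{n-1}}{n}\sum_{r_j+s_j>0,\ j=1,\dots,n}\frac{[p^{r_1}q^{s_1}\cdots p^{r_n}q^{s_n}]}{\sum_{j=1}^n(r_j+s_j)\,\prod_{j=1}^n r_j!\,s_j!}=p+q+\tfrac12[p,q]+\cdots, \] where $[p^{r_1}q^{s_1}\cdots p^{r_n}q^{s_n}]$ denotes the right-nested iterated bracket of the word; the neutral element is $0$ and $p^{-1}=-p$. Its dilations $\delta_\lambda$, $\lambda>0$, are the linear maps with $\delta_\lambda v=\lambda^j v$ for $v\in V_j$. A \emph{homogeneous distance} is a distance $\rho$ on $V$ with $\rho(gx,gy)=\rho(x,y)$ and $\rho(\delta_\lambda x,\delta_\lambda y)=\lambda\rho(x,y)$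 for all $g,x,y\in V$ and $\lambda>0$. A \emph{Carnot group} is a stratified group with a homogeneous distance; its topology is that of the finite-dimensional vector space $V$. Let $(\mathbb G,\rho)$ and $(\mathbb G',\rho')$ be Carnot groups, let $\Omega\subset\mathbb G$ be open and let $f:\Omega\to\mathbb G'$. Let $\mathrm{Hom}_h(\mathbb G;\mathbb G')$ be the set of homogeneous morphisms, i.e. of linear Lie algebra morphisms $L$ with $L(V_j)\subset V_j'$ for all $j$, with the distance $d(L,M)=\sup_{v\neq 0}\rho'(L(v),M(v))/\rho(0,v)$. The map $f$ is \emph{Pansu differentiable} at $p\in\Omega$, with Pansu differential $D_Hf_p=L\in\mathrm{Hom}_h(\mathbb G;\mathbb G')$, if \[ \lim_{x\to p}\frac{\rho'\big(f(p)^{-1}f(x),\,L(p^{-1}x)\big)}{\rho(p,x)}=0; \] it is \emph{of class $C^1_H$ on $\Omega$} if it is Pansu differentiable at every point of $\Omega$ and $p\mapsto D_Hf_p$ is continuous from $\Omega$ to $\mathrm{Hom}_h(\mathbb G;\mathbb G')$; and it is \emph{strictly Pansu differentiable} at $p\in\Omega$ if there is $L\in\mathrm{Hom}_h(\mathbb G;\mathbb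 G')$ such that \[ \lim_{\varepsilon\to0^+}\ \sup\left\{\frac{\rho'\big(f(y)^{-1}f(x),\,L(y^{-1}x)\big)}{\rho(x,y)}\ :\ x,y\in\Omega,\ \rho(p,x)<\varepsilon,\ \rho(p,y)<\varepsilon,\ x\neq y\right\}=0 . \] Then $f$ is of class $C^1_H$ on $\Omega$ if and only if $f$ is strictly Pansu differentiable at every point of $\Omega$. -/

import Mathlib

open Filter Topology
open scoped ENNReal

noncomputable section

namespace Carnot

/-- A stratification of step `step` of a real Lie algebra `V`: a direct sum decomposition
`V = V₁ ⊕ ⋯ ⊕ V_step` with `[V_i, V_j] ⊆ V_{i+j}` (this and the decomposition are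
Mathlib's `GradedLieAlgebra`), `[V₁, V_j] = V_{j+1}` for all `j ≥ 1`, and `V_step ≠ {0}`.
The layers are indexed by `ℕ`, with the convention `V_k = {0}` for `k = 0` and for `k > step`.
The zero Lie algebra is allowed, with `step = 0`. -/
structure Stratification (V : Type*) [LieRing V] [LieAlgebra ℝ V] where
  step : ℕ
  layer : ℕ → Submodule ℝ V
  graded : GradedLieAlgebra layer
  layer_zero : layer 0 = ⊥
  layer_of_step_lt : ∀ k, step < k → layer k = ⊥
  span_bracket : ∀ j, 1 ≤ j →
    Submodule.span ℝ {x : V | ∃ v ∈ layer 1, ∃ w ∈ layer j, ⁅v, w⁆ = x} = layer (j + 1)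
  layer_step_ne_bot : step ≠ 0 → layer step ≠ ⊥

attribute [instance] Stratification.graded

/-- The right-nested bracket `[a₁, [a₂, … [a_{k-1}, a_k] … ]]` of a nonempty list of vectors. -/
def nestedBracket {V : Type*} [LieRing V] : List V → V
  | [] => 0
  | [a] => a
  | a :: b :: l => ⁅a, nestedBracket (b :: l)⁆

namespace Stratification

variable {V : Type*} [LieRing V] [LieAlgebra ℝ V] (S : Stratification V)

/-- The dilation `δ_t`: multiplication by `t ^ j` on the layer `V_j`. -/
def dilation (t : ℝ) (v : V) : V :=
  ∑ j ∈ Finset.range (S.step + 1), t ^ j • (DirectSum.decompose S.layer v j : V)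

/-- The pairs `(r, s)` of exponents with `r + s > 0`. Pairs with `r > step` or `s > step` are
left out: they only occur in words of more than `step` letters, whose nested brackets vanish
(see `nestedBracket_eq_zero` below). -/
def exponents : Finset (ℕ × ℕ) :=
  (Finset.range (S.step + 1) ×ˢ Finset.range (S.step + 1)).filter fun a => 0 < a.1 + a.2

/-- The group law on `V` given by the Baker-Campbell-Hausdorff formula (in Dynkin's form)
`p q = ∑_{n ≥ 1} (-1)^{n-1}/n ∑_{r_j + s_j > 0}
  [p^{r_1} q^{s_1} ⋯ p^{r_n} q^{s_n}] / ((∑_j (r_j + s_j)) ∏_j r_j! s_j!)`.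
The terms with `n > step` vanish, see `nestedBracket_eq_zero`. The neutral element is `0`, and the
inverse of `p` is `-p`. -/
def mul (p q : V) : V :=
  ∑ n ∈ Finset.Icc 1 S.step, ((-1 : ℝ) ^ (n - 1) / (n : ℝ)) •
    ∑ w ∈ Fintype.piFinset (fun _ : Fin n => S.exponents),
      (((∑ j, ((w j).1 + (w j).2) : ℕ) : ℝ) *
          ((∏ j, (w j).1.factorial * (w j).2.factorial : ℕ) : ℝ))⁻¹ •
        nestedBracket
          (List.ofFn fun j => List.replicate (w j).1 p ++ List.replicate (w j).2 q).flatten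

theorem nestedBracket_mem (l : List V) :
    nestedBracket l ∈ ⨆ k : {k : ℕ // l.length ≤ k}, S.layer k := by
  have htop : ∀ a : V, a ∈ ⨆ k : ℕ, S.layer k := fun a => by
    rw [(DirectSum.Decomposition.isInternal S.layer).submodule_iSup_eq_top]; trivial
  induction l using nestedBracket.induct with
  | case1 => exact Submodule.zero_mem _
  | case2 a =>
    have hle : (⨆ k : ℕ, S.layer k) ≤ ⨆ k : {k : ℕ // [a].length ≤ k}, S.layer k := by
      refine iSup_le fun k => ?_
      rcases Nat.eq_zero_or_pos k with rfl | hk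
      · rw [S.layer_zero]; exact bot_le
      · exact le_iSup (fun k : {k : ℕ // [a].length ≤ k} => S.layer k) ⟨k, hk⟩
    exact hle (htop a)
  | case3 a b l ih =>
    simp only [nestedBracket]
    refine Submodule.iSup_induction (fun k : {k : ℕ // (b :: l).length ≤ k} => S.layer k)
      (motive := fun x => ⁅a, x⁆ ∈ ⨆ k : {k : ℕ // (a :: b :: l).length ≤ k}, S.layer k)
      ih ?_ ?_ ?_
    · rintro ⟨k, hk⟩ x hx
      refine Submodule.iSup_induction S.layer
        (motive := fun y => ⁅y, x⁆ ∈ ⨆ k : {k : ℕ // (a :: b :: l).length ≤ k}, S.layer k)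
        (htop a) ?_ ?_ ?_
      · intro i y hy
        rcases Nat.eq_zero_or_pos i with rfl | hi
        · rw [S.layer_zero, Submodule.mem_bot] at hy
          simp [hy]
        · have hik : (a :: b :: l).length ≤ i + k := by
            simp only [List.length_cons] at hk ⊢; omega
          exact Submodule.mem_iSup_of_mem
            (p := fun k : {k : ℕ // (a :: b :: l).length ≤ k} => S.layer k) ⟨i + k, hik⟩
            (SetLike.GradedBracket.bracket_mem hy hx)
      · simp
      · intro y z hy hz
        rw [add_lie]; exact Submodule.add_mem _ hy hz
    · simp
    · intro y z hy hz
      rw [lie_add]; exact Submodule.add_mem _ hy hz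

/-- Nested brackets of more than `step` letters vanish, so that the sum in `mul` is the full
Baker-Campbell-Hausdorff series. -/
theorem nestedBracket_eq_zero (l : List V) (h : S.step < l.length) : nestedBracket l = 0 := by
  have hl := S.nestedBracket_mem l
  have hbot : (⨆ k : {k : ℕ // l.length ≤ k}, S.layer k) = ⊥ := by
    rw [iSup_eq_bot]
    rintro ⟨k, hk⟩
    exact S.layer_of_step_lt k (lt_of_lt_of_le h hk)
  rwa [hbot, Submodule.mem_bot] at hl

end Stratification

/-- A homogeneous distance on the stratified group `(V, S)`: a distance function that is
left-invariant and 1-homogeneous with respect to the dilations. A stratified group with a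
homogeneous distance is a Carnot group. -/
structure HomogeneousDistance {V : Type*} [LieRing V] [LieAlgebra ℝ V]
    (S : Stratification V) where
  dist : V → V → ℝ
  dist_eq_zero : ∀ x y, dist x y = 0 ↔ x = y
  dist_comm : ∀ x y, dist x y = dist y x
  dist_triangle : ∀ x y z, dist x z ≤ dist x y + dist y z
  dist_mul_left : ∀ g x y, dist (S.mul g x) (S.mul g y) = dist x y
  dist_dilation : ∀ t : ℝ, 0 < t → ∀ x y, dist (S.dilation t x) (S.dilation t y) = t * dist x y

/-- A homogeneous morphism: a linear map that is a morphism of Lie algebras and maps each layer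
`V_j` into `V'_j`. -/
structure HomogeneousHom {V V' : Type*} [LieRing V] [LieAlgebra ℝ V] [LieRing V']
    [LieAlgebra ℝ V'] (S : Stratification V) (S' : Stratification V') extends V →ₗ⁅ℝ⁆ V' where
  map_layer : ∀ j, ∀ v ∈ S.layer j, toLieHom v ∈ S'.layer j

section Pansu

variable {V V' : Type*} [LieRing V] [LieAlgebra ℝ V] [LieRing V'] [LieAlgebra ℝ V']
  {S : Stratification V} {S' : Stratification V'}
  (ρ : HomogeneousDistance S) (ρ' : HomogeneousDistance S')

/-- The distance `sup_{v ≠ 0} ρ'(L v, M v) / ρ(0, v)` between two homogeneous morphisms. -/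
def homDist (L M : HomogeneousHom S S') : ℝ≥0∞ :=
  ⨆ (v : V) (_ : v ≠ 0), ENNReal.ofReal (ρ'.dist (L.toLieHom v) (M.toLieHom v) / ρ.dist 0 v)

/-- `L` is a Pansu differential at `p` of the map `f` defined on `Ω`. -/
def HasPansuDifferentialAt [TopologicalSpace V] (Ω : Set V) (f : V → V')
    (L : HomogeneousHom S S') (p : V) : Prop :=
  Tendsto
    (fun x => ρ'.dist (S'.mul (-f p) (f x)) (L.toLieHom (S.mul (-p) x)) / ρ.dist p x)
    (𝓝[Ω \ {p}] p) (𝓝 0)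

/-- `f` is of class `C¹_H` on `Ω`: it is Pansu differentiable at all points of `Ω`, and the Pansu
differential depends continuously on the point. -/
def IsC1H [TopologicalSpace V] (Ω : Set V) (f : V → V') : Prop :=
  ∃ D : V → HomogeneousHom S S',
    (∀ p ∈ Ω, HasPansuDifferentialAt ρ ρ' Ω f (D p) p) ∧
      ∀ p ∈ Ω, Tendsto (fun q => homDist ρ ρ' (D q) (D p)) (𝓝[Ω] p) (𝓝 0)

/-- `f`, defined on `Ω`, is strictly Pansu differentiable at `p`. The supremum is taken in
`[0, ∞]`. -/
def IsStrictlyPansuDifferentiableAt (Ω : Set V) (f : V → V') (p : V) : Prop :=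
  ∃ L : HomogeneousHom S S',
    Tendsto
      (fun ε : ℝ =>
        ⨆ (x : V) (y : V) (_ : x ∈ Ω ∧ y ∈ Ω ∧ ρ.dist p x < ε ∧ ρ.dist p y < ε ∧ x ≠ y),
          ENNReal.ofReal
            (ρ'.dist (S'.mul (-f y) (f x)) (L.toLieHom (S.mul (-y) x)) / ρ.dist x y))
      (𝓝[>] 0) (𝓝 0)

end Pansu

end Carnot

end

/-! Strict differentiability implies `C^1_H` by testing increments. Fixing one of the two points at
`p` gives the Pansu differential `D p`. For `q` near `p`, the increment of `f` from `q` to `q δ_t v`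
is approximated both by `D q (δ_t v)` and by `D p (δ_t v)`, up to a small multiple of `t ρ(0, v)`.
Homogeneity removes `t`, and `D q` is close to `D p` uniformly in `v`
(`isC1H_of_isStrictlyPansuDifferentiableAt`).

The converse is a blow-up. Put `r = ρ(x, y)` and `u = δ_{1/r}(y⁻¹ x)`, so that `u` lies on the unit
sphere of `ρ` and converges along an ultrafilter. It suffices that the rescaled increments
`δ_{1/r}(f(y)⁻¹ f(y δ_r u))` converge to `D p (lim u)` as `y → p`, `r → 0` (`tendsto_increment`).
The families `u` with this property, for all base points `y → p`, are closed under products and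
inverses, because increments telescope. The first layer generates the group in a way compatible with
limits (`mem_of_tendsto`), so only `u = c a` with `a` horizontal matters. There the rescaled image
of a horizontal segment is a curve whose left logarithmic derivative is `c D(γ) a`, uniformly close
to the constant `c₀ D(p) a` by continuity of `D`. The product being triangular with respect to the
layers, its endpoint converges, layer by layer (`tendsto_endpoint_of_curves`).

All this needs the Baker-Campbell-Hausdorff product to be a group law. Dynkin's formula is proved
for nilpotent elements of associative algebras (`exp_dynkin`) and transported through a faithful
nilpotent representation of `V` (`rep`), which yields associativity and the second order expansion
of commutators. The distance is not assumed continuous: its compatibility with the vector space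
topology is derived from homogeneity and the same generation principle. -/

namespace Carnot

/-! ### Truncated exponential and logarithm as mutually inverse polynomials modulo `X ^ M`. -/

open Polynomial in
-- The coefficient of `X ^ k` in the differential expression is `(k + 1) g_{k+1} + e (k - 1) g_k`,
-- so the coefficients of `g` vanish one after the other. The values `e = 0` and `e = 1` serve `log
-- ∘ exp` and `exp ∘ log`.
theorem X_pow_dvd_of_derivative_recurrence {M : ℕ} {g : ℚ[X]} {e : ℚ} (h0 : g.coeff 0 = 0)
    (h : X ^ (M - 1) ∣ (1 + C e * X) * derivative g - C e * g) : X ^ M ∣ g := by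
  rw [X_pow_dvd_iff] at h ⊢
  intro d
  induction d with
  | zero => intro _; exact h0
  | succ k ih =>
    intro hk
    have hgk := ih (by omega)
    have := h k (by omega)
    rw [add_mul, one_mul, mul_assoc, coeff_sub, coeff_add, coeff_C_mul, coeff_C_mul, hgk,
      coeff_derivative] at this
    rcases k with _ | k
    · simpa using this
    · rw [coeff_X_mul, coeff_derivative, hgk] at this
      have h2 : ((k : ℚ) + 1 + 1) ≠ 0 := by positivity
      simpa [h2] using this

/-- The logarithm series at `1 + u`, truncated after the power `M`. -/
noncomputable def logTrunc {A : Type*} [Ring A] [Module ℝ A] (M : ℕ) (u : A) : A :=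
  ∑ n ∈ Finset.Icc 1 M, ((-1 : ℝ) ^ (n - 1) / (n : ℝ)) • u ^ n

open Polynomial in
/-- The truncated exponential as a polynomial. -/
noncomputable def expPoly (M : ℕ) : ℚ[X] := ∑ k ∈ Finset.range M, C ((k.factorial : ℚ)⁻¹) * X ^ k

open Polynomial in
/-- The truncated logarithm of `1 + X` as a polynomial. -/
noncomputable def logPoly (M : ℕ) : ℚ[X] :=
  ∑ n ∈ Finset.range M, C ((-1 : ℚ) ^ n / (n + 1)) * X ^ (n + 1)

open Polynomial in
theorem derivative_expPoly (M : ℕ) :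
    derivative (expPoly (M + 1)) = expPoly M := by
  rw [expPoly, Finset.sum_range_succ', derivative_add, derivative_sum, expPoly]
  simp only [pow_zero, mul_one, derivative_C, add_zero]
  refine Finset.sum_congr rfl fun k _ => ?_
  rw [derivative_C_mul_X_pow, Nat.factorial_succ]
  congr 2
  have : (k.factorial : ℚ) ≠ 0 := by positivity
  have : ((k : ℚ) + 1) ≠ 0 := by positivity
  push_cast
  field_simp

open Polynomial in
theorem derivative_logPoly (M : ℕ) :
    (1 + X) * derivative (logPoly M) = 1 - (-X) ^ M := by
  have : derivative (logPoly M) = ∑ n ∈ Finset.range M, (-X : ℚ[X]) ^ n := by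
    rw [logPoly, derivative_sum]
    refine Finset.sum_congr rfl fun k _ => ?_
    rw [derivative_C_mul_X_pow, neg_pow (X : ℚ[X]), show k + 1 - 1 = k from rfl]
    congr 1
    have : ((k : ℚ) + 1) ≠ 0 := by positivity
    push_cast
    rw [div_mul_cancel₀ _ this]
    simp
  rw [this]
  have := mul_neg_geom_sum (-X : ℚ[X]) M
  simpa using this

open Polynomial in
theorem expPoly_coeff_zero (M : ℕ) : (expPoly (M + 1)).coeff 0 = 1 := by
  rw [expPoly, Finset.sum_range_succ']
  simp [coeff_X_pow]

open Polynomial in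
theorem logPoly_coeff_zero (M : ℕ) : (logPoly M).coeff 0 = 0 := by
  simp [logPoly, coeff_X_pow]

open Polynomial in
theorem X_pow_dvd_logPoly_comp (M : ℕ) :
    X ^ M ∣ (logPoly M).comp (expPoly M - 1) - X := by
  rcases M with _ | M
  · simp
  have hX : X ∣ expPoly (M + 1) - 1 := by
    rw [X_dvd_iff]; simp [expPoly_coeff_zero]
  have hXl : X ∣ (logPoly (M + 1)).comp (expPoly (M + 1) - 1) := by
    refine hX.trans ?_
    have : X ∣ logPoly (M + 1) := by rw [X_dvd_iff, logPoly_coeff_zero]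
    obtain ⟨q, hq⟩ := this
    rw [hq, mul_comp, X_comp]
    exact dvd_mul_right _ _
  refine X_pow_dvd_of_derivative_recurrence (e := 0) ?_ ?_
  · rw [← X_dvd_iff]; exact dvd_sub hXl dvd_rfl
  · simp only [map_zero, zero_mul, add_zero, one_mul, sub_zero, Nat.add_sub_cancel]
    rw [derivative_sub, derivative_comp, derivative_X, derivative_sub, derivative_one, sub_zero,
      derivative_expPoly]
    have h := congrArg (fun r => r.comp (expPoly (M + 1) - 1)) (derivative_logPoly (M + 1))
    simp only [mul_comp, add_comp, one_comp, X_comp, sub_comp, pow_comp, neg_comp] at h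
    have h2 : expPoly (M + 1) = expPoly M + C ((M.factorial : ℚ)⁻¹) * X ^ M := by
      rw [expPoly, Finset.sum_range_succ, expPoly]
    set D := (derivative (logPoly (M + 1))).comp (expPoly (M + 1) - 1)
    -- The chain rule with `(1 + X) log' = 1 - (-X)^(M+1)` at `exp - 1`; the other error comes from
    -- differentiation lowering the truncation order of `exp`.
    have h3 : expPoly M * D - 1 =
        - (-(expPoly (M + 1) - 1)) ^ (M + 1) - C ((M.factorial : ℚ)⁻¹) * D * X ^ M := by
      linear_combination h - D * h2
    rw [h3]
    refine dvd_sub (dvd_neg.mpr ?_) (dvd_mul_left _ _)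
    rw [neg_pow]
    exact Dvd.dvd.mul_left ((pow_dvd_pow X (Nat.le_succ M)).trans (pow_dvd_pow_of_dvd hX _)) _

open Polynomial in
-- Both `exp (log (1 + X))` and `1 + X` solve `(1 + X) y' = y` modulo `X ^ (M - 1)` with value `1`
-- at the origin.
theorem X_pow_dvd_expPoly_comp (M : ℕ) :
    X ^ M ∣ (expPoly M).comp (logPoly M) - (1 + X) := by
  rcases M with _ | M
  · simp
  have hX : X ∣ logPoly (M + 1) := by rw [X_dvd_iff, logPoly_coeff_zero]
  refine X_pow_dvd_of_derivative_recurrence (e := 1) ?_ ?_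
  · have : X ∣ expPoly (M + 1) - 1 := by rw [X_dvd_iff]; simp [expPoly_coeff_zero]
    obtain ⟨q, hq⟩ := this
    rw [sub_eq_iff_eq_add] at hq
    rw [hq, ← X_dvd_iff]
    simp only [add_comp, mul_comp, X_comp, one_comp]
    have : logPoly (M + 1) * q.comp (logPoly (M + 1)) + 1 - (1 + X) =
      logPoly (M + 1) * q.comp (logPoly (M + 1)) - X := by ring
    rw [this]
    exact dvd_sub (hX.mul_right _) dvd_rfl
  · simp only [map_one, one_mul, Nat.add_sub_cancel]
    rw [derivative_sub, derivative_comp, derivative_add, derivative_X, derivative_one, zero_add,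
      derivative_expPoly]
    have h := derivative_logPoly (M + 1)
    have h2 : expPoly (M + 1) = expPoly M + C ((M.factorial : ℚ)⁻¹) * X ^ M := by
      rw [expPoly, Finset.sum_range_succ, expPoly]
    have h2' := congrArg (fun r => r.comp (logPoly (M + 1))) h2
    simp only [add_comp, mul_comp, C_comp, pow_comp, X_comp] at h2'
    set L := logPoly (M + 1)
    set D := derivative L
    have h3 : (1 + X) * (D * (expPoly M).comp L - 1) - ((expPoly (M + 1)).comp L - (1 + X)) =
        - ((expPoly M).comp L * (-X) ^ (M + 1)) - C ((M.factorial : ℚ)⁻¹) * L ^ M := by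
      linear_combination (expPoly M).comp L * h - h2'
    rw [h3]
    refine dvd_sub (dvd_neg.mpr ?_) ?_
    · rw [neg_pow]
      exact Dvd.dvd.mul_left (Dvd.dvd.mul_left (pow_dvd_pow X (Nat.le_succ M)) _) _
    · exact Dvd.dvd.mul_left (pow_dvd_pow_of_dvd hX _) _

section

variable {A : Type*} [Ring A] [Algebra ℚ A]

open Polynomial in
theorem aeval_expPoly (M : ℕ) {a : A} (ha : a ^ M = 0) :
    aeval a (expPoly M) = IsNilpotent.exp a := by
  rw [IsNilpotent.exp_eq_sum ha, expPoly, map_sum]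
  refine Finset.sum_congr rfl fun k _ => ?_
  rw [map_mul, aeval_C, map_pow, aeval_X, Algebra.smul_def]

variable [Algebra ℝ A]

open Polynomial in
theorem aeval_logPoly (M : ℕ) (a : A) : aeval a (logPoly M) = logTrunc M a := by
  rw [logTrunc, logPoly, map_sum, Finset.range_eq_Ico, ← Finset.Ico_add_one_right_eq_Icc,
    Finset.sum_Ico_eq_sum_range, Finset.sum_Ico_eq_sum_range]
  refine Finset.sum_congr rfl fun k _ => ?_
  rw [map_mul, aeval_C, map_pow, aeval_X, ← Algebra.smul_def, ← Rat.cast_smul_eq_qsmul ℝ]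
  simp [add_comm]

theorem logTrunc_exp_sub_one {M : ℕ} {a : A} (ha : a ^ M = 0) :
    logTrunc M (IsNilpotent.exp a - 1) = a := by
  obtain ⟨q, hq⟩ := X_pow_dvd_logPoly_comp M
  have := congrArg (Polynomial.aeval a) hq
  rw [map_sub, Polynomial.aeval_comp, map_sub, aeval_expPoly M ha, map_mul, map_pow,
    Polynomial.aeval_X, ha, zero_mul, map_one, aeval_logPoly, sub_eq_zero] at this
  exact this

theorem logTrunc_pow_eq_zero {M : ℕ} {u : A} (hu : u ^ M = 0) : (logTrunc M u) ^ M = 0 := by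
  have hX : Polynomial.X ∣ logPoly M := by rw [Polynomial.X_dvd_iff, logPoly_coeff_zero]
  obtain ⟨q, hq⟩ := pow_dvd_pow_of_dvd hX M
  have := congrArg (Polynomial.aeval u) hq
  rwa [map_pow, map_mul, map_pow, Polynomial.aeval_X, hu, zero_mul, aeval_logPoly] at this

theorem exp_logTrunc {M : ℕ} {u : A} (hu : u ^ M = 0) :
    IsNilpotent.exp (logTrunc M u) = 1 + u := by
  obtain ⟨q, hq⟩ := X_pow_dvd_expPoly_comp M
  have := congrArg (Polynomial.aeval u) hq
  rw [map_sub, Polynomial.aeval_comp, aeval_logPoly, aeval_expPoly M (logTrunc_pow_eq_zero hu),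
    map_mul, map_pow, Polynomial.aeval_X, hu, zero_mul, map_add, map_one, Polynomial.aeval_X,
    sub_eq_zero] at this
  exact this

end


/-! ### Words in two letters and logarithms of products of exponentials. -/

section Associative

attribute [local instance] LieRing.ofAssociativeRing

/-- The two-letter word `p^{r_1} q^{s_1} ⋯ p^{r_n} q^{s_n}`, with `true` for `p`, `false` for `q`. -/
def word {n : ℕ} (w : Fin n → ℕ × ℕ) : List Bool :=
  (List.ofFn fun j => List.replicate (w j).1 true ++ List.replicate (w j).2 false).flatten

/-- The nonzero pairs of exponents bounded by `M`. -/
def exponentPairs (M : ℕ) : Finset (ℕ × ℕ) :=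
  (Finset.range (M + 1) ×ˢ Finset.range (M + 1)).filter fun a => 0 < a.1 + a.2

/-- The Dynkin series truncated at blocks and exponents at most `M`. -/
noncomputable def dynkin {V : Type*} [LieRing V] [LieAlgebra ℝ V] (M : ℕ) (p q : V) : V :=
  ∑ n ∈ Finset.Icc 1 M, ((-1 : ℝ) ^ (n - 1) / (n : ℝ)) •
    ∑ w ∈ Fintype.piFinset (fun _ : Fin n => exponentPairs M),
      (((∑ j, ((w j).1 + (w j).2) : ℕ) : ℝ) *
          ((∏ j, (w j).1.factorial * (w j).2.factorial : ℕ) : ℝ))⁻¹ •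
        nestedBracket ((word w).map fun b => cond b p q)

theorem word_map {α : Type*} (p q : α) {n : ℕ} (w : Fin n → ℕ × ℕ) :
    (word w).map (fun b => cond b p q) =
      (List.ofFn fun j => List.replicate (w j).1 p ++ List.replicate (w j).2 q).flatten := by
  simp [word, List.map_flatten, List.map_ofFn, Function.comp_def]

theorem word_succ {n : ℕ} (w : Fin (n + 1) → ℕ × ℕ) :
    word w = List.replicate (w 0).1 true ++ (List.replicate (w 0).2 false ++
      word (fun j => w j.succ)) := by
  simp [word, List.ofFn_succ]

theorem length_word {n : ℕ} (w : Fin n → ℕ × ℕ) :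
    (word w).length = ∑ j, ((w j).1 + (w j).2) := by
  induction n with
  | zero => simp [word]
  | succ n ih => rw [word_succ, Fin.sum_univ_succ]; simp [ih, add_assoc]

theorem pos_of_mem_exponentPairs {M : ℕ} {a : ℕ × ℕ} (h : a ∈ exponentPairs M) :
    0 < a.1 + a.2 := (Finset.mem_filter.1 h).2

theorem le_length_word {M n : ℕ} {w : Fin n → ℕ × ℕ}
    (hw : w ∈ Fintype.piFinset (fun _ : Fin n => exponentPairs M)) : n ≤ (word w).length := by
  rw [length_word]
  calc n = ∑ _j : Fin n, 1 := by simp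
    _ ≤ _ := Finset.sum_le_sum fun j _ =>
      pos_of_mem_exponentPairs (Fintype.mem_piFinset.1 hw j)

theorem sum_pow_eq_sum_prod_ofFn {R ι : Type*} [DecidableEq ι] [Semiring R] (s : Finset ι)
    (f : ι → R) (n : ℕ) :
    (∑ a ∈ s, f a) ^ n =
      ∑ w ∈ Fintype.piFinset (fun _ : Fin n => s), (List.ofFn fun j => f (w j)).prod := by
  induction n with
  | zero => simp
  | succ n ih =>
    rw [pow_succ', ih, Finset.sum_mul_sum, ← Finset.sum_product']
    refine Finset.sum_nbij' (fun a => (Fin.cons a.1 a.2 : Fin (n + 1) → ι))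
      (fun w => (w 0, fun j => w j.succ)) ?_ ?_ ?_ ?_ ?_
    · rintro ⟨a, w⟩ h
      rw [Finset.mem_product, Fintype.mem_piFinset] at h
      rw [Fintype.mem_piFinset]
      intro j
      refine Fin.cases ?_ (fun j => ?_) j
      · simpa using h.1
      · simpa using h.2 j
    · intro w h
      rw [Fintype.mem_piFinset] at h
      simp [Finset.mem_product, Fintype.mem_piFinset, h]
    · rintro ⟨a, w⟩ _; simp
    · intro w _
      funext j
      refine Fin.cases ?_ (fun j => ?_) j <;> simp
    · rintro ⟨a, w⟩ _; simp [List.ofFn_succ]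

theorem prod_ofFn_smul {R : Type*} [Ring R] [Algebra ℝ R] (P Q : R) {n : ℕ}
    (w : Fin n → ℕ × ℕ) :
    (List.ofFn fun j => (((w j).1.factorial * (w j).2.factorial : ℕ) : ℝ)⁻¹ •
        (P ^ (w j).1 * Q ^ (w j).2)).prod =
      ((∏ j, (w j).1.factorial * (w j).2.factorial : ℕ) : ℝ)⁻¹ •
        ((word w).map fun b => cond b P Q).prod := by
  induction n with
  | zero => simp [word]
  | succ n ih =>
    rw [List.ofFn_succ, List.prod_cons, ih, word_succ, Fin.prod_univ_succ]
    simp only [List.map_append, List.prod_append, List.map_replicate, List.prod_replicate,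
      cond_true, cond_false]
    rw [smul_mul_smul_comm, mul_assoc, Nat.cast_mul (m := _ * _), mul_inv]

theorem exp_mul_exp_sub_one {R : Type*} [Ring R] [Algebra ℝ R] [Algebra ℚ R] {P Q : R} {M : ℕ}
    (hP : P ^ (M + 1) = 0) (hQ : Q ^ (M + 1) = 0) :
    IsNilpotent.exp P * IsNilpotent.exp Q - 1 =
      ∑ a ∈ exponentPairs M, ((a.1.factorial * a.2.factorial : ℕ) : ℝ)⁻¹ •
        (P ^ a.1 * Q ^ a.2) := by
  rw [IsNilpotent.exp_eq_sum hP, IsNilpotent.exp_eq_sum hQ, Finset.sum_mul_sum,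
    ← Finset.sum_product']
  have hset : exponentPairs M =
      (Finset.range (M + 1) ×ˢ Finset.range (M + 1)).erase (0, 0) := by
    ext ⟨a, b⟩
    simp [exponentPairs]
    omega
  rw [hset, ← Finset.add_sum_erase _ _ (a := ((0 : ℕ), (0 : ℕ))) (by simp)]
  simp only [Nat.factorial_zero, Nat.cast_one, inv_one, pow_zero, one_smul, mul_one,
    add_sub_cancel_left]
  refine Finset.sum_congr rfl fun a _ => ?_
  rw [smul_mul_smul_comm, ← Rat.cast_smul_eq_qsmul ℝ]
  congr 1
  push_cast
  rw [mul_inv]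

theorem logTrunc_exp_mul_exp_sub_one {R : Type*} [Ring R] [Algebra ℝ R] [Algebra ℚ R] {P Q : R}
    {M : ℕ} (hP : P ^ (M + 1) = 0) (hQ : Q ^ (M + 1) = 0) :
    logTrunc M (IsNilpotent.exp P * IsNilpotent.exp Q - 1) =
      ∑ n ∈ Finset.Icc 1 M, ((-1 : ℝ) ^ (n - 1) / (n : ℝ)) •
        ∑ w ∈ Fintype.piFinset (fun _ : Fin n => exponentPairs M),
          ((∏ j, (w j).1.factorial * (w j).2.factorial : ℕ) : ℝ)⁻¹ •
            ((word w).map fun b => cond b P Q).prod := by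
  rw [logTrunc]
  refine Finset.sum_congr rfl fun n _ => ?_
  rw [exp_mul_exp_sub_one hP hQ, sum_pow_eq_sum_prod_ofFn]
  simp only [prod_ofFn_smul]

/-- The last letter of the word turns `E` into minus itself, and the remaining letters then act by
bracketing. Evaluation at such an `E` thus converts associative words in adjoint maps into nested
brackets. -/
theorem prod_ad_apply {L : Type*} [LieRing L] [LieAlgebra ℝ L] {P Q E : L}
    (hP : ⁅P, E⁆ = -P) (hQ : ⁅Q, E⁆ = -Q) (l : List Bool) (hl : l ≠ []) :
    ((l.map fun b => cond b (LieAlgebra.ad ℝ L P) (LieAlgebra.ad ℝ L Q)).prod) E =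
      -nestedBracket (l.map fun b => cond b P Q) := by
  have had : ∀ b, cond b (LieAlgebra.ad ℝ L P) (LieAlgebra.ad ℝ L Q) =
      LieAlgebra.ad ℝ L (cond b P Q) := by intro b; cases b <;> rfl
  have hE : ∀ b, ⁅cond b P Q, E⁆ = -cond b P Q := by intro b; cases b <;> assumption
  induction l with
  | nil => exact absurd rfl hl
  | cons b l ih =>
    rcases l with _ | ⟨c, l⟩
    · simp only [List.map_cons, List.map_nil, List.prod_cons, List.prod_nil, mul_one, had,
        LieAlgebra.ad_apply, hE, nestedBracket]
    · rw [List.map_cons, List.prod_cons, Module.End.mul_apply, ih (by simp), had,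
        LieAlgebra.ad_apply, lie_neg]
      simp [nestedBracket]

theorem exp_mulLeft {R : Type*} [Ring R] [Algebra ℝ R] [Algebra ℚ R] {a : R}
    (ha : IsNilpotent a) :
    IsNilpotent.exp (LinearMap.mulLeft ℝ a) = LinearMap.mulLeft ℝ (IsNilpotent.exp a) := by
  obtain ⟨k, hk⟩ := ha
  have hk' : (LinearMap.mulLeft ℝ a) ^ k = 0 := by rw [LinearMap.pow_mulLeft, hk]; ext; simp
  rw [IsNilpotent.exp_eq_sum hk, IsNilpotent.exp_eq_sum hk']
  ext x
  simp [LinearMap.pow_mulLeft, Finset.sum_mul]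

theorem exp_mulRight {R : Type*} [Ring R] [Algebra ℝ R] [Algebra ℚ R] {a : R}
    (ha : IsNilpotent a) :
    IsNilpotent.exp (LinearMap.mulRight ℝ a) = LinearMap.mulRight ℝ (IsNilpotent.exp a) := by
  obtain ⟨k, hk⟩ := ha
  have hk' : (LinearMap.mulRight ℝ a) ^ k = 0 := by rw [LinearMap.pow_mulRight, hk]; ext; simp
  rw [IsNilpotent.exp_eq_sum hk, IsNilpotent.exp_eq_sum hk']
  ext x
  simp [LinearMap.pow_mulRight, Finset.mul_sum]

/-- The map `ad a` is the sum of left multiplication by `a` and right multiplication by `-a`, which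
commute. -/
theorem exp_ad_apply {R : Type*} [Ring R] [Algebra ℝ R] [Algebra ℚ R] {a : R}
    (ha : IsNilpotent a) (x : R) :
    IsNilpotent.exp (LieAlgebra.ad ℝ R a) x =
      IsNilpotent.exp a * x * IsNilpotent.exp (-a) := by
  have hL : IsNilpotent (LinearMap.mulLeft ℝ a) := by
    rwa [LinearMap.isNilpotent_mulLeft_iff]
  have hR : IsNilpotent (LinearMap.mulRight ℝ (-a)) := by
    rw [LinearMap.isNilpotent_mulRight_iff]; exact ha.neg
  have : LieAlgebra.ad ℝ R a = LinearMap.mulLeft ℝ a + LinearMap.mulRight ℝ (-a) := by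
    ext y; simp [LieRing.of_associative_ring_bracket, sub_eq_add_neg]
  rw [this, IsNilpotent.exp_add_of_commute (LinearMap.commute_mulLeft_right _ _) hL hR,
    exp_mulLeft ha, exp_mulRight ha.neg]
  simp [mul_assoc]

theorem nestedBracket_map {L L' : Type*} [LieRing L] [LieAlgebra ℝ L] [LieRing L']
    [LieAlgebra ℝ L'] (φ : L →ₗ⁅ℝ⁆ L') (l : List L) :
    φ (nestedBracket l) = nestedBracket (l.map φ) := by
  induction l using nestedBracket.induct with
  | case1 => simp [nestedBracket]
  | case2 a => simp [nestedBracket]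
  | case3 a b l ih => simp only [nestedBracket, LieHom.map_lie, ih, List.map_cons]

theorem dynkin_map {L L' : Type*} [LieRing L] [LieAlgebra ℝ L] [LieRing L']
    [LieAlgebra ℝ L'] (φ : L →ₗ⁅ℝ⁆ L') (M : ℕ) (p q : L) :
    φ (dynkin M p q) = dynkin M (φ p) (φ q) := by
  have : ∀ b, φ (cond b p q) = cond b (φ p) (φ q) := by intro b; cases b <;> rfl
  simp only [dynkin, map_sum, map_smul, nestedBracket_map, List.map_map, Function.comp_def, this]

open Polynomial in
theorem nestedBracket_C_mul_X {A : Type*} [Ring A] (p q : A) (l : List Bool) :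
    nestedBracket (l.map fun b => cond b (C p * X) (C q * X)) =
      C (nestedBracket (l.map fun b => cond b p q)) * X ^ l.length := by
  have h : ∀ b, cond b (C p * X) (C q * X) = C (cond b p q) * X := by
    intro b; cases b <;> rfl
  induction l with
  | nil => simp [nestedBracket]
  | cons b l ih =>
    rcases l with _ | ⟨c, l⟩
    · simp [nestedBracket, h]
    · simp only [List.map_cons, nestedBracket] at ih ⊢
      rw [ih, h, LieRing.of_associative_ring_bracket, LieRing.of_associative_ring_bracket]
      simp only [List.length_cons, map_sub, map_mul, sub_mul]
      have e : ∀ (a b : A) (i j : ℕ), (C a * X ^ i) * (C b * X ^ j) = C a * C b * X ^ (i + j) := by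
        intro a b i j
        rw [mul_assoc, ← mul_assoc (X ^ i), X_pow_mul, mul_assoc, mul_assoc, ← pow_add]
      have e1 := e (cond b p q) (nestedBracket (cond c p q :: l.map fun b => cond b p q)) 1
        (l.length + 1)
      have e2 := e (nestedBracket (cond c p q :: l.map fun b => cond b p q)) (cond b p q)
        (l.length + 1) 1
      rw [pow_one] at e1 e2
      rw [e1, e2, add_comm 1]

end Associative


/-! ### The Euler operator and Dynkin's formula in an associative algebra. -/

section Associative

attribute [local instance] LieRing.ofAssociativeRing

open Polynomial in
/-- The Euler operator `X d/dX` on polynomials with coefficients in an algebra. -/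
noncomputable def eulerOperator (A : Type*) [Ring A] [Algebra ℝ A] : Module.End ℝ A[X] where
  toFun f := X * derivative f
  map_add' f g := by rw [derivative_add, mul_add]
  map_smul' c f := by rw [derivative_smul, mul_smul_comm]; rfl

open Polynomial in
-- This is the Leibniz rule. On degree one polynomials it gives the relation `[P, E] = -P` required
-- by `prod_ad_apply`.
theorem lie_lmul_eulerOperator {A : Type*} [Ring A] [Algebra ℝ A] (f : A[X]) :
    ⁅Algebra.lmul ℝ A[X] f, eulerOperator A⁆ = -Algebra.lmul ℝ A[X] (X * derivative f) := by
  rw [LieRing.of_associative_ring_bracket]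
  refine LinearMap.ext fun g => ?_
  simp only [LinearMap.sub_apply, Module.End.mul_apply, eulerOperator, LinearMap.coe_mk,
    AddHom.coe_mk, Algebra.coe_lmul_eq_mul, LinearMap.mul_apply', LinearMap.neg_apply,
    derivative_mul, mul_add]
  rw [← mul_assoc f, ← X_mul, mul_assoc, mul_assoc]
  abel

open Polynomial in
theorem lie_lmul_C_mul_X_eulerOperator {A : Type*} [Ring A] [Algebra ℝ A] (a : A) :
    ⁅Algebra.lmul ℝ A[X] (C a * X), eulerOperator A⁆ = -Algebra.lmul ℝ A[X] (C a * X) := by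
  rw [lie_lmul_eulerOperator]
  simp [X_mul]

/-- Conjugation by `exp Λ` is the composition of the conjugations by `exp P` and `exp Q`; the
truncated logarithm recovers `ad Λ`. -/
theorem logTrunc_exp_ad_mul_exp_ad {R : Type*} [Ring R] [Algebra ℝ R] [Algebra ℚ R] {P Q Λ : R}
    (hP : IsNilpotent P) (hQ : IsNilpotent Q) (hΛ : IsNilpotent Λ)
    (h : IsNilpotent.exp Λ = IsNilpotent.exp P * IsNilpotent.exp Q) {M : ℕ}
    (hM : (LieAlgebra.ad ℝ R Λ) ^ M = 0) :
    LieAlgebra.ad ℝ R Λ = logTrunc M (IsNilpotent.exp (LieAlgebra.ad ℝ R P) *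
      IsNilpotent.exp (LieAlgebra.ad ℝ R Q) - 1) := by
  have hneg : IsNilpotent.exp (-Λ) = IsNilpotent.exp (-Q) * IsNilpotent.exp (-P) := by
    refine left_inv_eq_right_inv (IsNilpotent.exp_neg_mul_exp_self hΛ) ?_
    rw [h, mul_assoc, ← mul_assoc (IsNilpotent.exp Q), IsNilpotent.exp_mul_exp_neg_self hQ,
      one_mul, IsNilpotent.exp_mul_exp_neg_self hP]
  have : IsNilpotent.exp (LieAlgebra.ad ℝ R P) * IsNilpotent.exp (LieAlgebra.ad ℝ R Q) =
      IsNilpotent.exp (LieAlgebra.ad ℝ R Λ) := by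
    refine LinearMap.ext fun x => ?_
    rw [Module.End.mul_apply, exp_ad_apply hP, exp_ad_apply hQ, exp_ad_apply hΛ, h, hneg]
    simp only [mul_assoc]
  rw [this, logTrunc_exp_sub_one hM]

/-- The sum of the terms of the truncated Dynkin series, each multiplied by its degree. -/
noncomputable def dynkinEuler {L : Type*} [LieRing L] [LieAlgebra ℝ L] (M : ℕ) (P Q : L) : L :=
  ∑ n ∈ Finset.Icc 1 M, ((-1 : ℝ) ^ (n - 1) / (n : ℝ)) •
    ∑ w ∈ Fintype.piFinset (fun _ : Fin n => exponentPairs M),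
      ((∏ j, (w j).1.factorial * (w j).2.factorial : ℕ) : ℝ)⁻¹ •
        nestedBracket ((word w).map fun b => cond b P Q)

theorem dynkinEuler_map {L L' : Type*} [LieRing L] [LieAlgebra ℝ L] [LieRing L']
    [LieAlgebra ℝ L'] (φ : L →ₗ⁅ℝ⁆ L') (M : ℕ) (p q : L) :
    φ (dynkinEuler M p q) = dynkinEuler M (φ p) (φ q) := by
  have : ∀ b, φ (cond b p q) = cond b (φ p) (φ q) := by intro b; cases b <;> rfl
  simp only [dynkinEuler, map_sum, map_smul, nestedBracket_map, List.map_map, Function.comp_def,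
    this]

theorem sum_prod_ad_apply {L : Type*} [LieRing L] [LieAlgebra ℝ L] {P Q E : L}
    (hP : ⁅P, E⁆ = -P) (hQ : ⁅Q, E⁆ = -Q) (M : ℕ) :
    (∑ n ∈ Finset.Icc 1 M, ((-1 : ℝ) ^ (n - 1) / (n : ℝ)) •
        ∑ w ∈ Fintype.piFinset (fun _ : Fin n => exponentPairs M),
          ((∏ j, (w j).1.factorial * (w j).2.factorial : ℕ) : ℝ)⁻¹ •
            ((word w).map fun b => cond b (LieAlgebra.ad ℝ L P) (LieAlgebra.ad ℝ L Q)).prod) E =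
      -dynkinEuler M P Q := by
  simp only [dynkinEuler, LinearMap.sum_apply, LinearMap.smul_apply, ← Finset.sum_neg_distrib]
  refine Finset.sum_congr rfl fun n hn => ?_
  rw [← smul_neg, ← Finset.sum_neg_distrib]
  congr 1
  refine Finset.sum_congr rfl fun w hw => ?_
  have hlen : 0 < (word w).length := (Finset.mem_Icc.1 hn).1.trans (le_length_word hw)
  rw [prod_ad_apply hP hQ _ (List.ne_nil_of_length_pos hlen), smul_neg]

open Polynomial in
/-- The truncated Dynkin series of `p X` and `q X`. -/
noncomputable def dynkinPoly {A : Type*} [Ring A] [Algebra ℝ A] (M : ℕ) (p q : A) : A[X] :=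
  ∑ n ∈ Finset.Icc 1 M, ((-1 : ℝ) ^ (n - 1) / (n : ℝ)) •
    ∑ w ∈ Fintype.piFinset (fun _ : Fin n => exponentPairs M),
      (((∑ j, ((w j).1 + (w j).2) : ℕ) : ℝ) *
          ((∏ j, (w j).1.factorial * (w j).2.factorial : ℕ) : ℝ))⁻¹ •
        (C (nestedBracket ((word w).map fun b => cond b p q)) * X ^ (word w).length)

open Polynomial in
-- Differentiation brings down the length of each word, which cancels the factor `(∑ (r_j + s_j))⁻¹`
-- of the Dynkin series.
theorem X_mul_derivative_dynkinPoly {A : Type*} [Ring A] [Algebra ℝ A] (M : ℕ) (p q : A) :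
    X * derivative (dynkinPoly M p q) = dynkinEuler M (C p * X) (C q * X) := by
  simp only [dynkinPoly, dynkinEuler, derivative_sum, derivative_smul, Finset.mul_sum, mul_smul_comm]
  refine Finset.sum_congr rfl fun n hn => ?_
  congr 1
  refine Finset.sum_congr rfl fun w hw => ?_
  have hlen : 0 < (word w).length := (Finset.mem_Icc.1 hn).1.trans (le_length_word hw)
  rw [nestedBracket_C_mul_X, derivative_C_mul_X_pow, ← length_word, mul_inv, mul_comm, mul_smul]
  congr 1
  obtain ⟨k, hk⟩ := Nat.exists_eq_succ_of_ne_zero hlen.ne'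
  rw [hk, Nat.succ_sub_one, X_mul, mul_assoc, ← pow_succ, ← smul_mul_assoc]
  congr 1
  rw [smul_C]
  congr 1
  have h0 : ((k + 1 : ℕ) : ℝ) ≠ 0 := by positivity
  rw [← nsmul_eq_mul', ← Nat.cast_smul_eq_nsmul ℝ, smul_smul, inv_mul_cancel₀ h0, one_smul]

open Polynomial in
/-- Dynkin's form of the Baker-Campbell-Hausdorff formula in an associative algebra. -/
theorem exp_dynkin {A : Type*} [Ring A] [Algebra ℝ A] [Algebra ℚ A] {p q : A}
    (hp : IsNilpotent p) (hq : IsNilpotent q)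
    (hU : IsNilpotent (IsNilpotent.exp (C p * X) * IsNilpotent.exp (C q * X) - 1)) :
    ∃ M₀, ∀ M, M₀ ≤ M → IsNilpotent (dynkin M p q) ∧
      IsNilpotent.exp (dynkin M p q) = IsNilpotent.exp p * IsNilpotent.exp q := by
  have hCX : ∀ {a : A}, IsNilpotent a → IsNilpotent (C a * X) := by
    rintro a ⟨k, hk⟩
    refine ⟨k, ?_⟩
    rw [(commute_X (C a)).symm.mul_pow, ← C_pow, hk, C_0, zero_mul]
  have hP := hCX hp
  have hQ := hCX hq
  obtain ⟨M₁, hM₁⟩ := hU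
  set P : A[X] := C p * X with hPdef
  set Q : A[X] := C q * X with hQdef
  set U := IsNilpotent.exp P * IsNilpotent.exp Q - 1 with hUdef
  set Λ := logTrunc M₁ U with hΛdef
  have hΛ : IsNilpotent Λ := ⟨M₁, logTrunc_pow_eq_zero hM₁⟩
  have hexp : IsNilpotent.exp Λ = IsNilpotent.exp P * IsNilpotent.exp Q := by
    rw [hΛdef, exp_logTrunc hM₁, hUdef]; abel
  let j := Algebra.lmul ℝ A[X]
  have hjP := hP.map j
  have hjQ := hQ.map j
  have hjΛ := hΛ.map j
  have hjexp : IsNilpotent.exp (j Λ) = IsNilpotent.exp (j P) * IsNilpotent.exp (j Q) := by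
    rw [← IsNilpotent.map_exp hΛ, ← IsNilpotent.map_exp hP, ← IsNilpotent.map_exp hQ, hexp,
      map_mul]
  obtain ⟨a, ha⟩ := LieAlgebra.ad_nilpotent_of_nilpotent (R := ℝ) hjP
  obtain ⟨b, hb⟩ := LieAlgebra.ad_nilpotent_of_nilpotent (R := ℝ) hjQ
  obtain ⟨c, hc⟩ := LieAlgebra.ad_nilpotent_of_nilpotent (R := ℝ) hjΛ
  -- the constant coefficient vanishes
  have hev : ∀ x : A, (∀ y, Commute y x) → ∃ φ : A[X] →+* A, ∀ g, φ g = g.eval x := fun x hx =>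
    ⟨eval₂RingHom' (RingHom.id A) x fun y => hx y, fun g => rfl⟩
  have hΛ0 : Λ.coeff 0 = 0 := by
    obtain ⟨φ, hφ⟩ := hev 0 fun y => Commute.zero_right y
    have hφP : φ P = 0 := by rw [hφ, hPdef, eval_mul_X]; simp
    have hφQ : φ Q = 0 := by rw [hφ, hQdef, eval_mul_X]; simp
    have hφU : φ U = 0 := by
      rw [hUdef, map_sub, map_mul, IsNilpotent.map_exp hP, IsNilpotent.map_exp hQ, hφP, hφQ]
      simp
    have h2 : φ Λ = 0 := by
      have hx : X ∣ logPoly M₁ := by rw [X_dvd_iff, logPoly_coeff_zero]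
      obtain ⟨r, hr⟩ := hx
      rw [hΛdef, ← aeval_logPoly, hr, map_mul, aeval_X, map_mul, hφU, zero_mul]
    rw [coeff_zero_eq_eval_zero, ← hφ, h2]
  refine ⟨max a (max b c), fun M hM => ?_⟩
  have had := logTrunc_exp_ad_mul_exp_ad hjP hjQ hjΛ hjexp (M := M)
    (pow_eq_zero_of_le (by omega) hc)
  rw [logTrunc_exp_mul_exp_sub_one (pow_eq_zero_of_le (by omega) ha)
    (pow_eq_zero_of_le (by omega) hb)] at had
  -- Applied to the Euler operator, the left side becomes `-X Λ'` and the right side minus the sum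
  -- of nested brackets without the degree factor.
  have hE := LinearMap.congr_fun had (eulerOperator A)
  rw [LieAlgebra.ad_apply, lie_lmul_eulerOperator] at hE
  have hder : X * derivative Λ = X * derivative (dynkinPoly M p q) := by
    have h1 : Function.Injective j := fun f g hfg => by
      have := LinearMap.congr_fun hfg 1
      simpa [j] using this
    apply h1
    rw [← neg_inj]
    refine hE.trans ?_
    rw [sum_prod_ad_apply (lie_lmul_C_mul_X_eulerOperator p) (lie_lmul_C_mul_X_eulerOperator q),
      X_mul_derivative_dynkinPoly]
    exact congrArg _ (dynkinEuler_map (j : A[X] →ₗ⁅ℝ⁆ Module.End ℝ A[X]) M P Q).symm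
  have hΛeq : Λ = dynkinPoly M p q := by
    ext k
    rcases k with _ | k
    · rw [hΛ0, dynkinPoly, finsetSum_coeff]
      symm
      refine Finset.sum_eq_zero fun n hn => ?_
      rw [coeff_smul, finsetSum_coeff, Finset.sum_eq_zero, smul_zero]
      intro w hw
      have hlen : 0 < (word w).length := (Finset.mem_Icc.1 hn).1.trans (le_length_word hw)
      rw [coeff_smul, coeff_C_mul_X_pow, if_neg hlen.ne, smul_zero]
    · have := congrArg (fun f => f.coeff (k + 1)) hder
      simp only [coeff_X_mul, coeff_derivative] at this
      have h0 : ((k : ℝ) + 1) ≠ 0 := by positivity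
      have e : ∀ x : A, x * ((k : A) + 1) = ((k : ℝ) + 1) • x := by
        intro x
        have := nsmul_eq_mul' x (k + 1)
        push_cast at this
        rw [← this, ← Nat.cast_smul_eq_nsmul ℝ]
        push_cast
        rfl
      rw [e, e] at this
      exact smul_right_injective A h0 this
  obtain ⟨φ, hφ⟩ := hev 1 fun y => Commute.one_right y
  have hφΛ : φ Λ = dynkin M p q := by
    rw [hφ, hΛeq, dynkinPoly, eval_finsetSum, dynkin]
    refine Finset.sum_congr rfl fun n _ => ?_
    rw [eval_smul, eval_finsetSum]
    congr 1
    refine Finset.sum_congr rfl fun w _ => ?_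
    rw [eval_smul]
    congr 1
    rw [← hφ, map_mul, map_pow, hφ, hφ]
    simp
  refine ⟨hφΛ ▸ hΛ.map φ, ?_⟩
  rw [← hφΛ, ← IsNilpotent.map_exp hΛ, hexp, map_mul, IsNilpotent.map_exp hP,
    IsNilpotent.map_exp hQ, hφ, hφ]
  simp [hPdef, hQdef]

end Associative


/-! ### Nilpotency from a filtration, and injectivity of the exponential. -/

section Associative

open Polynomial in
/-- Two elements of positive degree of a filtered algebra whose filtration reaches `0` satisfy the
assumptions of `exp_dynkin`. -/
theorem isNilpotent_of_filtration {A : Type*} [Ring A] [Algebra ℝ A] [Algebra ℚ A]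
    (N : ℕ → Submodule ℝ A) (h1 : (1 : A) ∈ N 0)
    (hmul : ∀ i j a b, a ∈ N i → b ∈ N j → a * b ∈ N (i + j)) (hanti : Antitone N)
    {K : ℕ} (hK : N K = ⊥) {p q : A} (hp : p ∈ N 1) (hq : q ∈ N 1) :
    IsNilpotent p ∧ IsNilpotent q ∧
      IsNilpotent (IsNilpotent.exp (C p * X) * IsNilpotent.exp (C q * X) - 1) := by
  have hpow : ∀ a ∈ N 1, ∀ n, a ^ n ∈ N n := by
    intro a ha n
    induction n with
    | zero => simpa using h1
    | succ n ih => rw [pow_succ]; exact hmul _ _ _ _ ih ha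
  have hnil : ∀ a ∈ N 1, a ^ K = 0 := fun a ha => by
    have := hpow a ha K
    rwa [hK, Submodule.mem_bot] at this
  refine ⟨⟨K, hnil p hp⟩, ⟨K, hnil q hq⟩, ?_⟩
  have hmulP : ∀ i j (f g : A[X]), (∀ m, f.coeff m ∈ N i) → (∀ m, g.coeff m ∈ N j) →
      ∀ m, (f * g).coeff m ∈ N (i + j) := by
    intro i j f g hf hg m
    rw [coeff_mul]
    exact Submodule.sum_mem _ fun x _ => hmul _ _ _ _ (hf _) (hg _)
  have hexp : ∀ a ∈ N 1, ∀ m, (IsNilpotent.exp (C a * X) - 1).coeff m ∈ N 1 := by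
    intro a ha m
    have hpw : ∀ k, (C a * X) ^ k = C (a ^ k) * X ^ k := by
      intro k
      rw [(commute_X (C a)).symm.mul_pow, ← C_pow]
    have h0 : (C a * X) ^ (K + 1) = 0 := by
      rw [hpw, pow_succ, hnil a ha, zero_mul, C_0, zero_mul]
    rw [IsNilpotent.exp_eq_sum h0, Finset.sum_range_succ']
    simp only [Nat.factorial_zero, Nat.cast_one, inv_one, pow_zero, one_smul,
      add_sub_cancel_right, finsetSum_coeff]
    refine Submodule.sum_mem _ fun k _ => ?_
    rw [hpw, ← Rat.cast_smul_eq_qsmul ℝ, coeff_smul, coeff_C_mul_X_pow]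
    refine Submodule.smul_mem _ _ ?_
    split_ifs
    · exact hanti (Nat.le_add_left 1 k) (hpow a ha (k + 1))
    · exact Submodule.zero_mem _
  set U := IsNilpotent.exp (C p * X) * IsNilpotent.exp (C q * X) - 1 with hU
  have hU1 : ∀ m, U.coeff m ∈ N 1 := by
    intro m
    have : U = (IsNilpotent.exp (C p * X) - 1) * (IsNilpotent.exp (C q * X) - 1) +
        (IsNilpotent.exp (C p * X) - 1) + (IsNilpotent.exp (C q * X) - 1) := by
      rw [hU]; noncomm_ring
    rw [this, coeff_add, coeff_add]
    exact Submodule.add_mem _ (Submodule.add_mem _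
      (hanti one_le_two (hmulP 1 1 _ _ (hexp p hp) (hexp q hq) m)) (hexp p hp m)) (hexp q hq m)
  have hUpow : ∀ n m, (U ^ n).coeff m ∈ N n := by
    intro n
    induction n with
    | zero =>
      intro m
      rw [pow_zero, coeff_one]
      split_ifs
      · exact h1
      · exact Submodule.zero_mem _
    | succ n ih => rw [pow_succ]; exact hmulP _ _ _ _ ih hU1
  refine ⟨K, ?_⟩
  ext m
  have := hUpow K m
  rwa [hK, Submodule.mem_bot] at this

theorem exp_injective_of_isNilpotent {A : Type*} [Ring A] [Algebra ℝ A] [Algebra ℚ A] {a b : A}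
    (ha : IsNilpotent a) (hb : IsNilpotent b)
    (h : IsNilpotent.exp a = IsNilpotent.exp b) : a = b := by
  obtain ⟨m, hm⟩ := ha
  obtain ⟨n, hn⟩ := hb
  rw [← logTrunc_exp_sub_one (pow_eq_zero_of_le (le_max_left m n) hm), h,
    logTrunc_exp_sub_one (pow_eq_zero_of_le (le_max_right m n) hn)]

end Associative

/-! ### Layers, the descending filtration and the grading derivation. -/

namespace Stratification

variable {V : Type*} [LieRing V] [LieAlgebra ℝ V] (S : Stratification V)

/-- The projection onto the layer `j`. -/
def proj (j : ℕ) : V →ₗ[ℝ] V where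
  toFun v := (DirectSum.decompose S.layer v j : V)
  map_add' v w := by simp
  map_smul' c v := by rw [DirectSum.decompose_smul]; rfl

theorem proj_mem (j : ℕ) (v : V) : S.proj j v ∈ S.layer j :=
  (DirectSum.decompose S.layer v j).2

theorem proj_of_mem {j : ℕ} {v : V} (hv : v ∈ S.layer j) : S.proj j v = v :=
  DirectSum.decompose_of_mem_same S.layer hv

theorem proj_of_mem_ne {i j : ℕ} {v : V} (hv : v ∈ S.layer i) (h : i ≠ j) : S.proj j v = 0 :=
  DirectSum.decompose_of_mem_ne S.layer hv h

theorem proj_proj (i j : ℕ) (v : V) : S.proj i (S.proj j v) = if i = j then S.proj i v else 0 := by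
  split_ifs with h
  · subst h; exact S.proj_of_mem (S.proj_mem _ _)
  · exact S.proj_of_mem_ne (S.proj_mem _ _) (Ne.symm h)

theorem proj_of_step_lt {j : ℕ} (hj : S.step < j) (v : V) : S.proj j v = 0 := by
  have := S.proj_mem j v
  rwa [S.layer_of_step_lt j hj, Submodule.mem_bot] at this

theorem proj_zero_apply (v : V) : S.proj 0 v = 0 := by
  have := S.proj_mem 0 v
  rwa [S.layer_zero, Submodule.mem_bot] at this

theorem sum_proj (v : V) : ∑ j ∈ Finset.range (S.step + 1), S.proj j v = v := by
  refine DirectSum.Decomposition.inductionOn S.layer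
    (motive := fun v => ∑ j ∈ Finset.range (S.step + 1), S.proj j v = v) ?_ ?_ ?_ v
  · simp
  · intro i m
    by_cases hi : S.step < i
    · have : (m : V) = 0 := by
        have h := (S.layer_of_step_lt i hi).le m.2
        exact (Submodule.mem_bot ℝ).1 h
      simp [this]
    · rw [Finset.sum_eq_single i, S.proj_of_mem m.2]
      · intro j _ hj; exact S.proj_of_mem_ne m.2 (Ne.symm hj)
      · intro h; simp only [Finset.mem_range] at h; omega
  · intro a b ha hb
    simp only [map_add, Finset.sum_add_distrib, ha, hb]

theorem ext_proj {v w : V} (h : ∀ j, S.proj j v = S.proj j w) : v = w := by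
  rw [← S.sum_proj v, ← S.sum_proj w]
  exact Finset.sum_congr rfl fun j _ => h j

/-- The filtration `V_k ⊕ V_{k+1} ⊕ ⋯`. -/
def fil (k : ℕ) : Submodule ℝ V where
  carrier := {v | ∀ i < k, S.proj i v = 0}
  add_mem' := by intro a b ha hb i hi; rw [map_add, ha i hi, hb i hi, add_zero]
  zero_mem' := by intro i _; exact map_zero _
  smul_mem' := by intro c a ha i hi; rw [map_smul, ha i hi, smul_zero]

theorem fil_anti : Antitone S.fil := fun _ _ h _ hv i hi => hv i (hi.trans_le h)

theorem layer_le_fil {j k : ℕ} (h : k ≤ j) : S.layer j ≤ S.fil k :=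
  fun _ hv i hi => S.proj_of_mem_ne hv (by omega)

theorem mem_fil_one (v : V) : v ∈ S.fil 1 := by
  intro i hi
  obtain rfl : i = 0 := by omega
  exact S.proj_zero_apply v

theorem eq_zero_of_mem_fil {k : ℕ} (hk : S.step < k) {v : V} (hv : v ∈ S.fil k) : v = 0 :=
  S.ext_proj fun j => by
    rw [map_zero]
    by_cases hj : j < k
    · exact hv j hj
    · exact S.proj_of_step_lt (by omega) v

theorem mem_fil_succ {k : ℕ} {v : V} (hv : v ∈ S.fil k) : v - S.proj k v ∈ S.fil (k + 1) := by
  intro i hi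
  rw [map_sub, S.proj_proj]
  split_ifs with h
  · rw [sub_self]
  · rw [hv i (by omega), sub_zero]

theorem lie_mem_fil {a b : ℕ} {x y : V} (hx : x ∈ S.fil a) (hy : y ∈ S.fil b) :
    ⁅x, y⁆ ∈ S.fil (a + b) := by
  rw [← S.sum_proj x, ← S.sum_proj y, sum_lie_sum]
  refine Submodule.sum_mem _ fun i _ => Submodule.sum_mem _ fun j _ => ?_
  by_cases hi : i < a
  · rw [hx i hi, zero_lie]; exact Submodule.zero_mem _
  by_cases hj : j < b
  · rw [hy j hj, lie_zero]; exact Submodule.zero_mem _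
  exact S.layer_le_fil (by omega)
    (SetLike.GradedBracket.bracket_mem (S.proj_mem i x) (S.proj_mem j y))

theorem lie_mem_fil_right {k : ℕ} (x : V) {y : V} (hy : y ∈ S.fil k) : ⁅x, y⁆ ∈ S.fil (k + 1) :=
  add_comm k 1 ▸ S.lie_mem_fil (S.mem_fil_one x) hy

/-- The derivation acting on the layer `j` as multiplication by `j`. -/
def gradeDerivation : LieDerivation ℝ V V :=
  LieDerivation.ofGrading S.layer (Nat.castAddMonoidHom ℝ)

theorem gradeDerivation_apply (v : V) :
    S.gradeDerivation v = ∑ j ∈ Finset.range (S.step + 1), (j : ℝ) • S.proj j v := by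
  conv_lhs => rw [← S.sum_proj v, map_sum]
  exact Finset.sum_congr rfl fun j _ =>
    LieDerivation.ofGrading_apply_apply S.layer _ (S.proj_mem j v)

/-- Only layers with `j ≥ 1` are nonzero, so all eigenvalues are positive. This detects central
elements too, which the adjoint representation does not. -/
theorem eq_zero_of_gradeDerivation_eq_zero {v : V} (h : S.gradeDerivation v = 0) : v = 0 := by
  refine S.ext_proj fun i => ?_
  rw [map_zero]
  rcases Nat.eq_zero_or_pos i with rfl | hi
  · exact S.proj_zero_apply v
  by_cases hs : S.step < i
  · exact S.proj_of_step_lt hs v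
  have := congrArg (S.proj i) h
  rw [gradeDerivation_apply, map_sum, map_zero, Finset.sum_eq_single i] at this
  · rw [map_smul, S.proj_proj, if_pos rfl, smul_eq_zero] at this
    exact this.resolve_left (by positivity)
  · intro j _ hj; rw [map_smul, S.proj_proj, if_neg (Ne.symm hj), smul_zero]
  · intro h; simp only [Finset.mem_range] at h; omega

/-- A larger truncation adds only words with more than `step` blocks or with an exponent above
`step`; these are longer than `step` and their brackets vanish. -/
theorem dynkin_eq_dynkin_step {M : ℕ} (hM : S.step ≤ M) (p q : V) :
    dynkin M p q = dynkin S.step p q := by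
  have hzero : ∀ {n : ℕ} (w : Fin n → ℕ × ℕ), S.step < (word w).length →
      nestedBracket ((word w).map fun b => cond b p q) = 0 := fun w h =>
    S.nestedBracket_eq_zero _ (by simpa using h)
  rw [dynkin, dynkin]
  symm
  rw [← Finset.sum_subset (s₁ := Finset.Icc 1 S.step) (s₂ := Finset.Icc 1 M)
    (Finset.Icc_subset_Icc_right hM)]
  · refine Finset.sum_congr rfl fun n _ => ?_
    congr 1
    refine Finset.sum_subset ?_ ?_
    · refine Fintype.piFinset_subset _ _ fun _ => ?_
      intro a ha
      simp only [exponentPairs, Finset.mem_filter, Finset.mem_product, Finset.mem_range] at ha ⊢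
      omega
    · intro w hw hw'
      rw [hzero, smul_zero]
      rw [Fintype.mem_piFinset] at hw'
      push Not at hw'
      obtain ⟨j, hj⟩ := hw'
      have h1 := Fintype.mem_piFinset.1 hw j
      simp only [exponentPairs, Finset.mem_filter, Finset.mem_product, Finset.mem_range] at hj h1
      have h2 : (w j).1 + (w j).2 ≤ (word w).length := by
        rw [length_word]
        exact Finset.single_le_sum (f := fun j => (w j).1 + (w j).2) (fun _ _ => Nat.zero_le _)
          (Finset.mem_univ j)
      omega
  · intro n hn hn'
    rw [Finset.sum_eq_zero, smul_zero]
    intro w hw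
    have := le_length_word hw
    simp only [Finset.mem_Icc] at hn hn'
    rw [hzero w (by omega), smul_zero]

theorem mul_eq_dynkin {M : ℕ} (hM : S.step ≤ M) (p q : V) : S.mul p q = dynkin M p q := by
  rw [S.dynkin_eq_dynkin_step hM, mul, dynkin]
  simp only [word_map]
  rfl

end Stratification


/-! ### Conjugation by exponentials. -/

section Associative

attribute [local instance] LieRing.ofAssociativeRing

/-- The upper bound `K + 2` exceeds what nilpotency requires, so that the terms of order `0` and `1`
can always be split off. -/
theorem exp_ad_apply_eq_sum {R : Type*} [Ring R] [Algebra ℝ R] [Algebra ℚ R] {a : R}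
    (ha : IsNilpotent a) : ∃ K, ∀ x : R, IsNilpotent.exp a * x * IsNilpotent.exp (-a) =
      ∑ i ∈ Finset.range (K + 2), (i.factorial : ℝ)⁻¹ • ((LieAlgebra.ad ℝ R a) ^ i) x := by
  obtain ⟨K, hK⟩ := LieAlgebra.ad_nilpotent_of_nilpotent (R := ℝ) ha
  refine ⟨K, fun x => ?_⟩
  rw [← exp_ad_apply ha, IsNilpotent.exp_eq_sum (k := K + 2) (pow_eq_zero_of_le (by omega) hK),
    LinearMap.sum_apply]
  refine Finset.sum_congr rfl fun i _ => ?_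
  rw [LinearMap.smul_apply, ← Rat.cast_smul_eq_qsmul ℝ]
  push_cast
  rfl

theorem exp_conj {R : Type*} [Ring R] [Module ℚ R] {a g : R} (ha : IsNilpotent a)
    (hg : IsNilpotent g) :
    IsNilpotent.exp a * IsNilpotent.exp g * IsNilpotent.exp (-a) =
      IsNilpotent.exp (IsNilpotent.exp a * g * IsNilpotent.exp (-a)) := by
  let u : Rˣ := ⟨IsNilpotent.exp a, IsNilpotent.exp (-a),
    IsNilpotent.exp_mul_exp_neg_self ha, IsNilpotent.exp_neg_mul_exp_self ha⟩
  have := IsNilpotent.map_exp hg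
    (MulSemiringAction.toRingHom (ConjAct Rˣ) R (ConjAct.toConjAct u))
  simpa [MulSemiringAction.toRingHom_apply, ConjAct.units_smul_def, u] using this

end Associative

/-! ### The terms of degree at least two of the Dynkin series. -/

section Tail

variable {V : Type*} [LieRing V] [LieAlgebra ℝ V]

/-- The terms of degree at least two of the truncated Dynkin series. -/
noncomputable def dynkinTail (M : ℕ) (p q : V) : V :=
  ∑ n ∈ Finset.Icc 1 M, ((-1 : ℝ) ^ (n - 1) / (n : ℝ)) •
    ∑ w ∈ Fintype.piFinset (fun _ : Fin n => exponentPairs M),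
      (((∑ j, ((w j).1 + (w j).2) : ℕ) : ℝ) *
          ((∏ j, (w j).1.factorial * (w j).2.factorial : ℕ) : ℝ))⁻¹ •
        if 2 ≤ (word w).length then nestedBracket ((word w).map fun b => cond b p q) else 0

/-- Words of length one occur only for `n = 1`, with exponents `(1, 0)` or `(0, 1)`, and contribute
`p` and `q`. -/
theorem dynkin_eq_add_dynkinTail {M : ℕ} (hM : 1 ≤ M) (p q : V) :
    dynkin M p q = p + q + dynkinTail M p q := by
  rw [← sub_eq_iff_eq_add, dynkin, dynkinTail, ← Finset.sum_sub_distrib,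
    Finset.sum_eq_single 1]
  · simp only [Nat.sub_self, pow_zero, Nat.cast_one, div_one, one_smul]
    rw [← Finset.sum_sub_distrib]
    have h10 : (fun _ => (1, 0) : Fin 1 → ℕ × ℕ) ∈
        Fintype.piFinset (fun _ : Fin 1 => exponentPairs M) := by
      simp [Fintype.mem_piFinset, exponentPairs]; omega
    have h01 : (fun _ => (0, 1) : Fin 1 → ℕ × ℕ) ∈
        (Fintype.piFinset (fun _ : Fin 1 => exponentPairs M)).erase (fun _ => (1, 0)) := by
      rw [Finset.mem_erase]
      refine ⟨fun h => by simpa using congrFun h 0, ?_⟩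
      simp [Fintype.mem_piFinset, exponentPairs]; omega
    rw [← Finset.add_sum_erase _ _ h10, ← Finset.add_sum_erase _ _ h01]
    refine congrArg₂ (· + ·) ?_
      ((congrArg₂ (· + ·) ?_ (Finset.sum_eq_zero ?_)).trans (add_zero _))
    · simp [word, nestedBracket]
    · simp [word, nestedBracket]
    · intro w hw
      rw [Finset.mem_erase, Finset.mem_erase] at hw
      have hne : ∀ a, w ≠ (fun _ => a) → w 0 ≠ a := fun a h h' => h <| by
        funext i; rw [Subsingleton.elim i 0, h']
      have h1 := hne _ hw.1
      have h2 := hne _ hw.2.1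
      have h3 := pos_of_mem_exponentPairs (Fintype.mem_piFinset.1 hw.2.2 0)
      have hlen : 2 ≤ (word w).length := by
        rw [length_word, Fin.sum_univ_one]
        by_contra hlt
        generalize w 0 = a at *
        obtain ⟨a, b⟩ := a
        simp only [ne_eq, Prod.mk.injEq] at h1 h2 h3 hlt
        omega
      rw [if_pos hlen, sub_self]
  · intro n hn hn1
    rw [sub_eq_zero]
    congr 1
    refine Finset.sum_congr rfl fun w hw => ?_
    have := le_length_word hw
    rw [Finset.mem_Icc] at hn
    rw [if_pos (by omega)]
  · intro h
    simp only [Finset.mem_Icc] at h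
    omega

/-- The innermost bracket involves two letters, hence is `0` or `±[p, q]`; the outer letters
preserve `I`. -/
theorem nestedBracket_mem_of_lie_mem {I : Submodule ℝ V} (hI : ∀ x : V, ∀ y ∈ I, ⁅x, y⁆ ∈ I)
    {p q : V} (h : ⁅p, q⁆ ∈ I) (l : List Bool) (hl : 2 ≤ l.length) :
    nestedBracket (l.map fun b => cond b p q) ∈ I := by
  induction l with
  | nil => simp at hl
  | cons b l ih =>
    rcases l with _ | ⟨c, _ | ⟨d, l⟩⟩
    · simp at hl
    · simp only [List.map_cons, List.map_nil, nestedBracket]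
      cases b <;> cases c <;> simp [h]
      rw [← lie_skew]; exact I.neg_mem h
    · exact hI _ _ (ih (by simp))

theorem dynkinTail_mem {I : Submodule ℝ V} (hI : ∀ x : V, ∀ y ∈ I, ⁅x, y⁆ ∈ I)
    {p q : V} (h : ⁅p, q⁆ ∈ I) (M : ℕ) : dynkinTail M p q ∈ I := by
  refine Submodule.sum_mem _ fun n _ => Submodule.smul_mem _ _ <|
    Submodule.sum_mem _ fun w _ => Submodule.smul_mem _ _ ?_
  split_ifs with hl
  · exact nestedBracket_mem_of_lie_mem hI h _ hl
  · exact I.zero_mem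

/-- Replacing `p` by `p'` changes a letter by an element of `J`, and any further bracket pushes the
change into `I`. The weaker membership in `J` is what the induction feeds on. -/
theorem nestedBracket_sub_mem {I J : Submodule ℝ V} (hIJ : I ≤ J)
    (hJ : ∀ x : V, ∀ y ∈ J, ⁅x, y⁆ ∈ I) {p p' : V} (h : p - p' ∈ J) (q : V) (l : List Bool) :
    nestedBracket (l.map fun b => cond b p q) - nestedBracket (l.map fun b => cond b p' q) ∈ J ∧
    (2 ≤ l.length → nestedBracket (l.map fun b => cond b p q) -
      nestedBracket (l.map fun b => cond b p' q) ∈ I) := by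
  have hc : ∀ b, cond b p q - cond b p' q ∈ J := by intro b; cases b <;> simp [h]
  induction l with
  | nil => simp [nestedBracket]
  | cons b l ih =>
    rcases l with _ | ⟨c, l⟩
    · simpa [nestedBracket] using hc b
    · have key : nestedBracket ((b :: c :: l).map fun b => cond b p q) -
          nestedBracket ((b :: c :: l).map fun b => cond b p' q) ∈ I := by
        have e : ∀ x x' y y' : V, ⁅x, y⁆ - ⁅x', y'⁆ = -⁅y, x - x'⁆ + ⁅x', y - y'⁆ := by
          intro x x' y y'
          rw [lie_sub, lie_sub, ← lie_skew x y, ← lie_skew x' y]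
          abel
        simp only [List.map_cons, nestedBracket] at ih ⊢
        rw [e]
        exact I.add_mem (I.neg_mem (hJ _ _ (hc b))) (hJ _ _ ih.1)
      exact ⟨hIJ key, fun _ => key⟩

theorem dynkinTail_sub_mem {I J : Submodule ℝ V} (hIJ : I ≤ J)
    (hJ : ∀ x : V, ∀ y ∈ J, ⁅x, y⁆ ∈ I) {p p' : V} (h : p - p' ∈ J) (q : V) (M : ℕ) :
    dynkinTail M p q - dynkinTail M p' q ∈ I := by
  simp only [dynkinTail, ← Finset.sum_sub_distrib, ← smul_sub]
  refine Submodule.sum_mem _ fun n _ => Submodule.smul_mem _ _ <|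
    Submodule.sum_mem _ fun w _ => Submodule.smul_mem _ _ ?_
  split_ifs with hl
  · exact (nestedBracket_sub_mem hIJ hJ h q _).2 hl
  · simp

end Tail

/-! ### The group law: associativity, conjugation and commutators. -/

namespace Stratification

variable {V : Type*} [LieRing V] [LieAlgebra ℝ V] (S : Stratification V)

theorem mul_eq_add_dynkinTail (p q : V) :
    S.mul p q = p + q + dynkinTail (S.step + 1) p q := by
  rw [S.mul_eq_dynkin (Nat.le_succ _), dynkin_eq_add_dynkinTail (by omega)]

/-- The product is the sum modulo any ideal containing the bracket. -/
theorem mul_sub_add_mem {I : Submodule ℝ V} (hI : ∀ x : V, ∀ y ∈ I, ⁅x, y⁆ ∈ I)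
    {p q : V} (h : ⁅p, q⁆ ∈ I) : S.mul p q - (p + q) ∈ I := by
  rw [mul_eq_add_dynkinTail, add_sub_cancel_left]
  exact dynkinTail_mem hI h _

theorem mul_sub_add_mem_fil {k : ℕ} {p q : V} (h : ⁅p, q⁆ ∈ S.fil k) :
    S.mul p q - (p + q) ∈ S.fil k :=
  S.mul_sub_add_mem (fun x _ hy => S.fil_anti (Nat.le_succ k) (S.lie_mem_fil_right x hy)) h

theorem mul_of_lie_eq_zero {p q : V} (h : ⁅p, q⁆ = 0) : S.mul p q = p + q := by
  have := S.mul_sub_add_mem (I := ⊥) (p := p) (q := q)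
    (by intro x y hy; rw [Submodule.mem_bot] at hy ⊢; rw [hy, lie_zero]) (by simpa using h)
  rwa [Submodule.mem_bot, sub_eq_zero] at this

theorem mul_zero (p : V) : S.mul p 0 = p := by
  rw [S.mul_of_lie_eq_zero (lie_zero p), add_zero]

theorem zero_mul (p : V) : S.mul 0 p = p := by
  rw [S.mul_of_lie_eq_zero (zero_lie p), zero_add]

theorem neg_mul_self (p : V) : S.mul (-p) p = 0 := by
  rw [S.mul_of_lie_eq_zero (by simp), neg_add_cancel]

theorem mul_neg_self (p : V) : S.mul p (-p) = 0 := by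
  rw [S.mul_of_lie_eq_zero (by simp), add_neg_cancel]

theorem smul_mul_smul (a b : ℝ) (x : V) : S.mul (a • x) (b • x) = (a + b) • x := by
  rw [S.mul_of_lie_eq_zero (by simp), add_smul]

/-- The component of degree `j` of `p q` depends on that of `p` additively and otherwise only on
the components of `p` of smaller degree. -/
theorem proj_mul_sub {j : ℕ} {p p' : V} (h : ∀ i < j, S.proj i p = S.proj i p') (q : V) :
    S.proj j (S.mul p q) - S.proj j p = S.proj j (S.mul p' q) - S.proj j p' := by
  have hp : p - p' ∈ S.fil j := fun i hi => by rw [map_sub, h i hi, sub_self]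
  have := dynkinTail_sub_mem (S.fil_anti (Nat.le_succ j))
    (fun x _ hy => S.lie_mem_fil_right x hy) hp q (S.step + 1) j (Nat.lt_succ_self j)
  rw [map_sub, sub_eq_zero] at this
  simp only [mul_eq_add_dynkinTail, map_add, this]
  abel

section Representation

attribute [local instance] LieRing.ofAssociativeRing

/-- A faithful nilpotent representation: the action of `V` on the extension of `V` by the grading
derivation. -/
def rep : V →ₗ⁅ℝ⁆ Module.End ℝ (V × ℝ) where
  toFun v :=
    { toFun := fun x => (⁅v, x.1⁆ - x.2 • S.gradeDerivation v, 0)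
      map_add' := fun x y => by
        simp only [Prod.fst_add, Prod.snd_add, lie_add, add_smul, Prod.mk_add_mk, add_zero]
        congr 1
        abel
      map_smul' := fun c x => by
        simp [smul_sub, mul_smul] }
  map_add' v w := by
    refine LinearMap.ext fun x => ?_
    simp only [map_add, add_lie, smul_add, LinearMap.coe_mk, AddHom.coe_mk, LinearMap.add_apply,
      Prod.mk_add_mk, add_zero]
    congr 1
    abel
  map_smul' c v := by
    refine LinearMap.ext fun x => ?_
    simp [smul_sub, smul_comm c]
  map_lie' {v w} := by
    refine LinearMap.ext fun x => ?_
    simp only [LieRing.of_associative_ring_bracket, LinearMap.coe_mk, AddHom.coe_mk,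
      LinearMap.sub_apply, Module.End.mul_apply, LieDerivation.apply_lie_eq_sub, zero_smul,
      sub_zero, lie_sub, lie_smul, lie_lie, smul_sub, Prod.mk_sub_mk]
    congr 1
    abel

theorem rep_apply (v : V) (x : V × ℝ) :
    S.rep v x = (⁅v, x.1⁆ - x.2 • S.gradeDerivation v, 0) := rfl

/-- The vector `(0, 1)` is sent to minus the grading derivation of `v`, which vanishes only for `v =
0`. -/
theorem rep_injective : Function.Injective S.rep := by
  rw [injective_iff_map_eq_zero]
  intro v hv
  have := LinearMap.congr_fun hv (0, 1)
  rw [rep_apply] at this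
  simp only [lie_zero, one_smul, zero_sub, LinearMap.zero_apply, Prod.mk_eq_zero, neg_eq_zero,
    and_true] at this
  exact S.eq_zero_of_gradeDerivation_eq_zero this

/-- The filtration of the extended algebra. -/
def repFil (k : ℕ) : Submodule ℝ (V × ℝ) := if k = 0 then ⊤ else (S.fil k).prod ⊥

theorem mem_repFil_succ {k : ℕ} {x : V × ℝ} :
    x ∈ S.repFil (k + 1) ↔ x.1 ∈ S.fil (k + 1) ∧ x.2 = 0 := by
  simp [repFil]

theorem repFil_anti : Antitone S.repFil := by
  refine antitone_nat_of_succ_le fun k => ?_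
  rcases k with _ | k
  · simp [repFil]
  · intro x hx
    rw [mem_repFil_succ] at hx ⊢
    exact ⟨S.fil_anti (Nat.le_succ _) hx.1, hx.2⟩

/-- The endomorphisms raising the filtration by `k`. -/
def endFil (k : ℕ) : Submodule ℝ (Module.End ℝ (V × ℝ)) where
  carrier := {T | ∀ i, ∀ x ∈ S.repFil i, T x ∈ S.repFil (i + k)}
  add_mem' := fun ha hb i x hx => Submodule.add_mem _ (ha i x hx) (hb i x hx)
  zero_mem' := fun _ _ _ => Submodule.zero_mem _
  smul_mem' := fun c _ ha i x hx => Submodule.smul_mem _ c (ha i x hx)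

theorem rep_mem_endFil (v : V) : S.rep v ∈ S.endFil 1 := by
  intro i x hx
  rw [rep_apply, mem_repFil_succ]
  refine ⟨?_, rfl⟩
  rcases i with _ | i
  · exact S.mem_fil_one _
  · rw [mem_repFil_succ] at hx
    simpa [hx.2] using S.lie_mem_fil_right v hx.1

theorem endFil_eq_bot : S.endFil (S.step + 1) = ⊥ := by
  rw [eq_bot_iff]
  intro T hT
  rw [Submodule.mem_bot]
  refine LinearMap.ext fun x => ?_
  have := hT 0 x (by simp [repFil])
  rw [zero_add, mem_repFil_succ] at this
  exact Prod.ext (S.eq_zero_of_mem_fil (Nat.lt_succ_self _) this.1) this.2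

/-- The rational algebra structure underlying a real algebra. -/
noncomputable abbrev ratAlgebra (A : Type*) [Ring A] [Algebra ℝ A] : Algebra ℚ A :=
  Algebra.compHom A (algebraMap ℚ ℝ)

attribute [local instance] ratAlgebra

theorem isNilpotent_rep (v : V) : IsNilpotent (S.rep v) ∧ ∀ w, ∃ M₀, ∀ M, M₀ ≤ M →
    IsNilpotent.exp (dynkin M (S.rep v) (S.rep w)) =
      IsNilpotent.exp (S.rep v) * IsNilpotent.exp (S.rep w) := by
  have h := fun w => isNilpotent_of_filtration S.endFil (fun i x hx => hx)
    (fun i j a b ha hb k x hx => by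
      have := ha _ _ (hb _ _ hx)
      rwa [add_assoc, add_comm j i] at this)
    (fun i j hij T hT k x hx => S.repFil_anti (by omega) (hT k x hx))
    S.endFil_eq_bot (S.rep_mem_endFil v) (S.rep_mem_endFil w)
  refine ⟨(h v).1, fun w => ?_⟩
  obtain ⟨h1, h2, h3⟩ := h w
  obtain ⟨M₀, hM⟩ := exp_dynkin h1 h2 h3
  exact ⟨M₀, fun M hM' => (hM M hM').2⟩

/-- The truncation order is free above `step`, so it can be taken beyond the threshold of
`exp_dynkin`. -/
theorem exp_rep_mul (p q : V) : IsNilpotent.exp (S.rep (S.mul p q)) =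
    IsNilpotent.exp (S.rep p) * IsNilpotent.exp (S.rep q) := by
  obtain ⟨M₀, hM⟩ := (S.isNilpotent_rep p).2 q
  rw [S.mul_eq_dynkin (le_max_left S.step M₀), dynkin_map, hM _ (le_max_right _ _)]

theorem eq_of_exp_rep_eq {p q : V}
    (h : IsNilpotent.exp (S.rep p) = IsNilpotent.exp (S.rep q)) : p = q :=
  S.rep_injective
    (exp_injective_of_isNilpotent (S.isNilpotent_rep p).1 (S.isNilpotent_rep q).1 h)

/-- Associativity of the Baker-Campbell-Hausdorff product. -/
theorem mul_assoc (p q r : V) : S.mul (S.mul p q) r = S.mul p (S.mul q r) :=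
  S.eq_of_exp_rep_eq (by simp only [exp_rep_mul, _root_.mul_assoc])

/-- Conjugation in the group is the exponential of the adjoint action, to second order. -/
theorem conj_sub_mem_fil {k : ℕ} (a : V) {g : V} (hg : g ∈ S.fil k) :
    S.mul (S.mul a g) (-a) - (g + ⁅a, g⁆) ∈ S.fil (k + 2) := by
  have ha := (S.isNilpotent_rep a).1
  obtain ⟨K, hK⟩ := exp_ad_apply_eq_sum ha
  -- Here `z` is `exp (ad a) g`; its image under `rep` is the conjugate of `rep g`, and faithfulness
  -- identifies it with the group conjugate.
  set z : V := ∑ i ∈ Finset.range (K + 2), ((i.factorial : ℝ)⁻¹) • ((LieAlgebra.ad ℝ V a) ^ i) g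
    with hz
  have hrep : S.rep z = IsNilpotent.exp (S.rep a) * S.rep g * IsNilpotent.exp (-S.rep a) := by
    rw [hK, hz, map_sum]
    refine Finset.sum_congr rfl fun i _ => ?_
    rw [map_smul]
    congr 1
    clear * -
    induction i with
    | zero => simp
    | succ i ih =>
      rw [pow_succ', pow_succ', Module.End.mul_apply, Module.End.mul_apply, LieAlgebra.ad_apply,
        LieHom.map_lie, ih, LieAlgebra.ad_apply]
  have hconj : S.mul (S.mul a g) (-a) = z := by
    apply S.eq_of_exp_rep_eq
    rw [exp_rep_mul, exp_rep_mul, hrep, map_neg, exp_conj ha (S.isNilpotent_rep g).1]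
  rw [hconj, hz, Finset.sum_range_succ', Finset.sum_range_succ']
  have hpow : ∀ i, ((LieAlgebra.ad ℝ V a) ^ i) g ∈ S.fil (k + i) := by
    intro i
    induction i with
    | zero => simpa using hg
    | succ i ih =>
      rw [pow_succ', Module.End.mul_apply, LieAlgebra.ad_apply]
      exact S.lie_mem_fil_right a ih
  have e : ∀ s : V, s + (((0 + 1 : ℕ).factorial : ℝ)⁻¹) • ((LieAlgebra.ad ℝ V a) ^ (0 + 1)) g +
      ((Nat.factorial 0 : ℝ)⁻¹) • ((LieAlgebra.ad ℝ V a) ^ 0) g - (g + ⁅a, g⁆) = s := by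
    intro s
    simp
    abel
  rw [e]
  exact Submodule.sum_mem _ fun i _ => Submodule.smul_mem _ _
    (S.fil_anti (by omega) (hpow (i + 1 + 1)))

end Representation

theorem neg_mul_cancel_left (p q : V) : S.mul (-p) (S.mul p q) = q := by
  rw [← S.mul_assoc, S.neg_mul_self, S.zero_mul]

theorem mul_neg_cancel_left (p q : V) : S.mul p (S.mul (-p) q) = q := by
  rw [← S.mul_assoc, S.mul_neg_self, S.zero_mul]

theorem neg_mul_rev (p q : V) : -S.mul p q = S.mul (-q) (-p) := by
  have : S.mul (S.mul p q) (S.mul (-q) (-p)) = 0 := by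
    rw [S.mul_assoc, S.mul_neg_cancel_left, S.mul_neg_self]
  rw [← S.mul_zero (-S.mul p q), ← this, S.neg_mul_cancel_left]

theorem neg_mul_mul_neg_mul (a b c : V) : S.mul (S.mul (-a) b) (S.mul (-b) c) = S.mul (-a) c := by
  rw [S.mul_assoc, S.mul_neg_cancel_left]

/-- The group commutator is the bracket to first order. -/
theorem commutator_sub_mem_fil {k : ℕ} (a : V) {g : V} (hg : g ∈ S.fil k) :
    S.mul (S.mul (S.mul a g) (-a)) (-g) - ⁅a, g⁆ ∈ S.fil (k + 2) := by
  set z := S.mul (S.mul a g) (-a)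
  have hz := S.conj_sub_mem_fil a hg
  have hag : ⁅a, g⁆ ∈ S.fil (k + 1) := S.lie_mem_fil_right a hg
  have hzg : z - g ∈ S.fil (k + 1) := by
    have := Submodule.add_mem _ (S.fil_anti (Nat.le_succ (k + 1)) hz) hag
    rwa [show z - (g + ⁅a, g⁆) + ⁅a, g⁆ = z - g by abel] at this
  have hlie : ⁅z, -g⁆ ∈ S.fil (k + 2) := by
    -- The bracket only sees `z - g`, which already lies one level deeper than `g`.
    have : ⁅z, -g⁆ = ⁅g, z - g⁆ := by
      rw [lie_sub, lie_self, sub_zero, lie_neg, lie_skew]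
    rw [this]
    exact S.lie_mem_fil_right g hzg
  have := Submodule.add_mem _ (S.mul_sub_add_mem_fil hlie) hz
  rwa [show S.mul z (-g) - (z + -g) + (z - (g + ⁅a, g⁆)) = S.mul z (-g) - ⁅a, g⁆ by abel] at this

end Stratification


/-! ### Morphisms and dilations. -/

namespace Stratification

variable {V : Type*} [LieRing V] [LieAlgebra ℝ V] (S : Stratification V)
  {V' : Type*} [LieRing V'] [LieAlgebra ℝ V'] {S' : Stratification V'}

/-- The product is a universal expression in brackets. The two steps may differ, hence the common
truncation at their maximum. -/
theorem map_mul (S' : Stratification V') (φ : V →ₗ⁅ℝ⁆ V') (p q : V) :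
    φ (S.mul p q) = S'.mul (φ p) (φ q) := by
  rw [S.mul_eq_dynkin (le_max_left S.step S'.step),
    S'.mul_eq_dynkin (le_max_right S.step S'.step), dynkin_map]

theorem dilation_eq_sum (t : ℝ) (v : V) :
    S.dilation t v = ∑ j ∈ Finset.range (S.step + 1), t ^ j • S.proj j v := rfl

theorem proj_dilation (j : ℕ) (t : ℝ) (v : V) :
    S.proj j (S.dilation t v) = t ^ j • S.proj j v := by
  rw [dilation_eq_sum, map_sum]
  by_cases hj : S.step < j
  · rw [S.proj_of_step_lt hj v, smul_zero]
    exact Finset.sum_eq_zero fun i _ => S.proj_of_step_lt hj _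
  · rw [Finset.sum_eq_single j]
    · rw [map_smul, S.proj_proj, if_pos rfl]
    · intro i _ hi; rw [map_smul, S.proj_proj, if_neg (Ne.symm hi), smul_zero]
    · intro h; simp only [Finset.mem_range] at h; omega

theorem dilation_of_mem {j : ℕ} {v : V} (hv : v ∈ S.layer j) (t : ℝ) :
    S.dilation t v = t ^ j • v :=
  S.ext_proj fun i => by
    rw [proj_dilation, map_smul]
    by_cases h : j = i
    · rw [h]
    · rw [S.proj_of_mem_ne hv h, smul_zero, smul_zero]

/-- The dilation as a morphism of Lie algebras. -/
def dilationHom (t : ℝ) : V →ₗ⁅ℝ⁆ V where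
  toFun := S.dilation t
  map_add' v w := S.ext_proj fun j => by simp only [proj_dilation, map_add, smul_add]
  map_smul' c v := S.ext_proj fun j => by
    simp only [proj_dilation, map_smul, RingHom.id_apply, smul_comm c]
  map_lie' {x y} := by
    have hadd : ∀ v w, S.dilation t (v + w) = S.dilation t v + S.dilation t w := fun v w =>
      S.ext_proj fun j => by simp only [proj_dilation, map_add, smul_add]
    let φ : V →+ V := AddMonoidHom.mk' (S.dilation t) hadd
    change φ ⁅x, y⁆ = _
    conv_lhs => rw [← S.sum_proj x, ← S.sum_proj y, sum_lie_sum]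
    simp only [map_sum]
    rw [S.dilation_eq_sum t x, S.dilation_eq_sum t y, sum_lie_sum]
    refine Finset.sum_congr rfl fun i _ => Finset.sum_congr rfl fun j _ => ?_
    change S.dilation t _ = _
    rw [S.dilation_of_mem (SetLike.GradedBracket.bracket_mem (S.proj_mem i x) (S.proj_mem j y)),
      smul_lie, lie_smul, smul_smul, pow_add]

theorem dilation_mul (t : ℝ) (p q : V) :
    S.dilation t (S.mul p q) = S.mul (S.dilation t p) (S.dilation t q) :=
  S.map_mul S (S.dilationHom t) p q

theorem dilation_neg (t : ℝ) (p : V) : S.dilation t (-p) = -S.dilation t p :=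
  map_neg (S.dilationHom t) p

theorem dilation_zero (t : ℝ) : S.dilation t 0 = 0 := map_zero (S.dilationHom t)

theorem dilation_dilation (s t : ℝ) (v : V) :
    S.dilation s (S.dilation t v) = S.dilation (s * t) v :=
  S.ext_proj fun j => by simp only [proj_dilation, smul_smul, mul_pow]

theorem dilation_one (v : V) : S.dilation 1 v = v :=
  S.ext_proj fun j => by simp only [proj_dilation, one_pow, one_smul]

theorem zero_dilation (v : V) : S.dilation 0 v = 0 :=
  S.ext_proj fun j => by
    rw [proj_dilation, map_zero]
    rcases j with _ | j
    · rw [S.proj_zero_apply, smul_zero]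
    · simp

theorem dilation_inv_dilation {t : ℝ} (ht : t ≠ 0) (v : V) :
    S.dilation t⁻¹ (S.dilation t v) = v := by
  rw [dilation_dilation, inv_mul_cancel₀ ht, dilation_one]

theorem dilation_dilation_inv {t : ℝ} (ht : t ≠ 0) (v : V) :
    S.dilation t (S.dilation t⁻¹ v) = v := by
  rw [dilation_dilation, mul_inv_cancel₀ ht, dilation_one]

end Stratification

namespace HomogeneousHom

variable {V V' : Type*} [LieRing V] [LieAlgebra ℝ V] [LieRing V'] [LieAlgebra ℝ V']
  {S : Stratification V} {S' : Stratification V'} (L : HomogeneousHom S S')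

theorem proj_apply (j : ℕ) (v : V) : S'.proj j (L.toLieHom v) = L.toLieHom (S.proj j v) := by
  conv_lhs => rw [← S.sum_proj v, map_sum, map_sum]
  by_cases hj : S.step < j
  · rw [S.proj_of_step_lt hj v, map_zero]
    refine Finset.sum_eq_zero fun i hi => ?_
    rw [Finset.mem_range] at hi
    exact S'.proj_of_mem_ne (L.map_layer i _ (S.proj_mem i v)) (by omega)
  · rw [Finset.sum_eq_single j]
    · exact S'.proj_of_mem (L.map_layer j _ (S.proj_mem j v))
    · intro i _ hi; exact S'.proj_of_mem_ne (L.map_layer i _ (S.proj_mem i v)) hi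
    · intro h; simp only [Finset.mem_range] at h; omega

theorem map_dilation (t : ℝ) (v : V) :
    L.toLieHom (S.dilation t v) = S'.dilation t (L.toLieHom v) :=
  S'.ext_proj fun j => by
    rw [S'.proj_dilation, proj_apply, proj_apply, S.proj_dilation, map_smul]

theorem map_mul (p q : V) :
    L.toLieHom (S.mul p q) = S'.mul (L.toLieHom p) (L.toLieHom q) :=
  S.map_mul S' L.toLieHom p q

end HomogeneousHom

/-! ### Continuity of the operations and generation by the first layer. -/

namespace Stratification

variable {V : Type*} [LieRing V] [LieAlgebra ℝ V] [FiniteDimensional ℝ V] [TopologicalSpace V]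
  [IsTopologicalAddGroup V] [ContinuousSMul ℝ V] [T2Space V] (S : Stratification V)

theorem continuous_proj (j : ℕ) : Continuous (S.proj j) :=
  LinearMap.continuous_of_finiteDimensional _

theorem continuous_lie : Continuous fun x : V × V => ⁅x.1, x.2⁆ := by
  let b := Module.finBasis ℝ V
  have h : ∀ x : V × V, ⁅x.1, x.2⁆ = ∑ i, ∑ j, (b.coord i x.1 * b.coord j x.2) • ⁅b i, b j⁆ := by
    intro x
    conv_lhs => rw [← b.sum_repr x.1, ← b.sum_repr x.2, sum_lie_sum]
    refine Finset.sum_congr rfl fun i _ => Finset.sum_congr rfl fun j _ => ?_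
    rw [smul_lie, lie_smul, smul_smul]
    rfl
  simp only [h]
  have hc : ∀ i, Continuous (b.coord i) := fun i => LinearMap.continuous_of_finiteDimensional _
  fun_prop

theorem continuous_nestedBracket (l : List Bool) :
    Continuous fun x : V × V => nestedBracket (l.map fun b => cond b x.1 x.2) := by
  have hc : ∀ b, Continuous fun x : V × V => cond b x.1 x.2 := by
    intro b; cases b
    · exact continuous_snd
    · exact continuous_fst
  induction l with
  | nil => exact continuous_const
  | cons b l ih =>
    rcases l with _ | ⟨c, l⟩
    · exact hc b
    · exact continuous_lie.comp ((hc b).prodMk ih)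

theorem continuous_mul : Continuous fun x : V × V => S.mul x.1 x.2 := by
  simp only [S.mul_eq_dynkin le_rfl, dynkin]
  refine continuous_finsetSum _ fun n _ => Continuous.const_smul ?_ _
  refine continuous_finsetSum _ fun w _ => Continuous.const_smul ?_ _
  exact continuous_nestedBracket _

theorem continuous_dilation : Continuous fun x : ℝ × V => S.dilation x.1 x.2 := by
  simp only [dilation_eq_sum]
  refine continuous_finsetSum _ fun j _ => ?_
  exact (continuous_fst.pow j).smul ((S.continuous_proj j).comp continuous_snd)

variable {S} {ι : Type*} {F : Filter ι}

theorem tendsto_mul {u v : ι → V} {u₀ v₀ : V} (hu : Tendsto u F (𝓝 u₀))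
    (hv : Tendsto v F (𝓝 v₀)) :
    Tendsto (fun n => S.mul (u n) (v n)) F (𝓝 (S.mul u₀ v₀)) := by
  have h := (S.continuous_mul.tendsto (u₀, v₀)).comp (hu.prodMk_nhds hv)
  simpa only [Function.comp_def] using h

theorem tendsto_dilation {t : ι → ℝ} {v : ι → V} {t₀ : ℝ} {v₀ : V} (ht : Tendsto t F (𝓝 t₀))
    (hv : Tendsto v F (𝓝 v₀)) :
    Tendsto (fun n => S.dilation (t n) (v n)) F (𝓝 (S.dilation t₀ v₀)) := by
  have h := (S.continuous_dilation.tendsto (t₀, v₀)).comp (ht.prodMk_nhds hv)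
  simpa only [Function.comp_def] using h

variable {P : Set (ι → V)}

/-- Since `V_{k+1}` is spanned by `[V_1, V_k]` and group commutators are brackets to first order,
iterated commutators of horizontal elements reach every direction of `V_k` modulo deeper layers. The
varying coefficient is carried by the innermost entry alone. -/
theorem exists_mem_sub_smul_mem_fil
    (hmul : ∀ u ∈ P, ∀ w ∈ P, (fun n => S.mul (u n) (w n)) ∈ P)
    (hneg : ∀ u ∈ P, (fun n => -u n) ∈ P)
    (hgen : ∀ a ∈ S.layer 1, ∀ (c : ι → ℝ) (c₀ : ℝ), Tendsto c F (𝓝 c₀) →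
      (fun n => c n • a) ∈ P)
    {k : ℕ} (hk : 1 ≤ k) : ∀ w ∈ S.layer k, ∀ (c : ι → ℝ) (c₀ : ℝ), Tendsto c F (𝓝 c₀) →
      ∃ g ∈ P, (∃ g₀, Tendsto g F (𝓝 g₀)) ∧ ∀ n, g n - c n • w ∈ S.fil (k + 1) := by
  induction k, hk using Nat.le_induction with
  | base =>
    intro w hw c c₀ hc
    exact ⟨_, hgen w hw c c₀ hc, ⟨_, hc.smul_const w⟩, fun n => by simp⟩
  | succ k hk ih =>
    intro w hw
    rw [← S.span_bracket k hk] at hw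
    induction hw using Submodule.span_induction with
    | mem x hx =>
      obtain ⟨v, hv, w, hw, rfl⟩ := hx
      intro c c₀ hc
      obtain ⟨g, hgP, ⟨g₀, hg₀⟩, hg⟩ := ih w hw c c₀ hc
      have hvP : (fun _ => v) ∈ P := by simpa using hgen v hv (fun _ => 1) 1 tendsto_const_nhds
      refine ⟨_, hmul _ (hmul _ (hmul _ hvP _ hgP) _ (hneg _ hvP)) _ (hneg _ hgP),
        ⟨_, tendsto_mul (tendsto_mul (tendsto_mul tendsto_const_nhds hg₀) tendsto_const_nhds)
          hg₀.neg⟩, fun n => ?_⟩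
      have hgk : g n ∈ S.fil k := by
        have := Submodule.add_mem _ (S.fil_anti (Nat.le_succ k) (hg n))
          (Submodule.smul_mem _ (c n) (S.layer_le_fil le_rfl hw))
        rwa [sub_add_cancel] at this
      have h1 := S.commutator_sub_mem_fil v hgk
      have h2 := S.lie_mem_fil_right v (hg n)
      have := Submodule.add_mem _ h1 h2
      rwa [lie_sub, lie_smul, sub_add_sub_cancel] at this
    | zero =>
      intro c c₀ hc
      exact ⟨_, hgen 0 (Submodule.zero_mem _) c c₀ hc, ⟨_, hc.smul_const 0⟩, fun n => by simp⟩
    | add x y hx hy ihx ihy =>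
      intro c c₀ hc
      obtain ⟨g, hgP, ⟨g₀, hg₀⟩, hg⟩ := ihx c c₀ hc
      obtain ⟨g', hgP', ⟨g₀', hg₀'⟩, hg'⟩ := ihy c c₀ hc
      refine ⟨_, hmul _ hgP _ hgP', ⟨_, tendsto_mul hg₀ hg₀'⟩, fun n => ?_⟩
      rw [S.span_bracket k hk] at hx hy
      have hmem : ∀ {g z : V}, z ∈ S.layer (k + 1) → g - c n • z ∈ S.fil (k + 1 + 1) →
          g ∈ S.fil (k + 1) := by
        intro g z hz h
        have := Submodule.add_mem _ (S.fil_anti (Nat.le_succ (k + 1)) h)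
          (Submodule.smul_mem _ (c n) (S.layer_le_fil le_rfl hz))
        rwa [sub_add_cancel] at this
      have h1 := S.mul_sub_add_mem_fil (S.fil_anti (show k + 1 + 1 ≤ (k + 1) + (k + 1) by omega)
        (S.lie_mem_fil (hmem hx (hg n)) (hmem hy (hg' n))))
      have := Submodule.add_mem _ h1 (Submodule.add_mem _ (hg n) (hg' n))
      rwa [show S.mul (g n) (g' n) - (g n + g' n) + (g n - c n • x + (g' n - c n • y)) =
        S.mul (g n) (g' n) - c n • (x + y) by rw [smul_add]; abel] at this
    | smul r x hx ihx =>
      intro c c₀ hc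
      obtain ⟨g, hgP, hg₀, hg⟩ := ihx _ _ (hc.mul_const r)
      exact ⟨g, hgP, hg₀, fun n => by rw [smul_smul]; exact hg n⟩

/-- A set of families of elements that is closed under products and inverses and contains the
convergent families along fixed horizontal directions contains all convergent families. -/
theorem mem_of_tendsto
    (hmul : ∀ u ∈ P, ∀ w ∈ P, (fun n => S.mul (u n) (w n)) ∈ P)
    (hneg : ∀ u ∈ P, (fun n => -u n) ∈ P)
    (hgen : ∀ a ∈ S.layer 1, ∀ (c : ι → ℝ) (c₀ : ℝ), Tendsto c F (𝓝 c₀) →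
      (fun n => c n • a) ∈ P)
    {u : ι → V} {u₀ : V} (hu : Tendsto u F (𝓝 u₀)) : u ∈ P := by
  have hzero : (fun _ => (0 : V)) ∈ P := by
    simpa using hgen 0 (Submodule.zero_mem _) (fun _ => 0) 0 tendsto_const_nhds
  -- Induction on the number `d` of layers still to be removed; at `k = step + 1` the family is
  -- identically `0`.
  suffices h : ∀ d k, 1 ≤ k → S.step + 1 = k + d → ∀ (u : ι → V) (u₀ : V),
      Tendsto u F (𝓝 u₀) → (∀ n, u n ∈ S.fil k) → u ∈ P from
    h S.step 1 le_rfl (by omega) u u₀ hu fun n => S.mem_fil_one _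
  intro d
  induction d with
  | zero =>
    intro k _ hkd u u₀ _ huk
    have : u = fun _ => 0 := funext fun n => S.eq_zero_of_mem_fil (by omega) (huk n)
    rwa [this]
  | succ d ih =>
    intro k hk hkd u u₀ hu huk
    let b := Module.finBasis ℝ (S.layer k)
    let pk : V →ₗ[ℝ] S.layer k := (S.proj k).codRestrict (S.layer k) (S.proj_mem k)
    let c : _ → ι → ℝ := fun i n => (b.coord i ∘ₗ pk) (u n)
    have hc : ∀ i, Tendsto (c i) F (𝓝 ((b.coord i ∘ₗ pk) u₀)) := fun i =>
      ((LinearMap.continuous_of_finiteDimensional (b.coord i ∘ₗ pk)).tendsto u₀).comp hu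
    have hsum : ∀ n, S.proj k (u n) = ∑ i, c i n • (b i : V) := by
      intro n
      have := congrArg (S.layer k).subtype (b.sum_repr (pk (u n)))
      rw [map_sum] at this
      exact this.symm
    have key : ∀ s : Finset _, ∃ g ∈ P, (∃ g₀, Tendsto g F (𝓝 g₀)) ∧
        ∀ n, g n - ∑ i ∈ s, c i n • (b i : V) ∈ S.fil (k + 1) := by
      intro s
      induction s using Finset.cons_induction with
      | empty => exact ⟨_, hzero, ⟨_, tendsto_const_nhds⟩, fun n => by simp⟩
      | cons i s hi ihs =>
        obtain ⟨g, hgP, ⟨g₀, hg₀⟩, hg⟩ := ihs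
        obtain ⟨g', hgP', ⟨g₀', hg₀'⟩, hg'⟩ :=
          exists_mem_sub_smul_mem_fil hmul hneg hgen hk (b i : V) (b i).2 (c i) _ (hc i)
        refine ⟨_, hmul _ hgP' _ hgP, ⟨_, tendsto_mul hg₀' hg₀⟩, fun n => ?_⟩
        have hgk : g n ∈ S.fil k := by
          have := Submodule.add_mem _ (S.fil_anti (Nat.le_succ k) (hg n))
            (Submodule.sum_mem (t := s) _ fun i _ => Submodule.smul_mem _ (c i n)
              (S.layer_le_fil le_rfl (b i).2))
          rwa [sub_add_cancel] at this
        have h1 := S.mul_sub_add_mem_fil (S.lie_mem_fil_right (g' n) hgk)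
        have := Submodule.add_mem _ h1 (Submodule.add_mem _ (hg' n) (hg n))
        rw [Finset.sum_cons]
        convert this using 1
        abel
    obtain ⟨g, hgP, ⟨g₀, hg₀⟩, hg⟩ := key Finset.univ
    -- Here `g` reproduces the component of `u` in layer `k`. The quotient lies one level deeper and
    -- still converges, because `g` does.
    have hrest : (fun n => S.mul (u n) (-g n)) ∈ P := by
      refine ih (k + 1) (by omega) (by omega) _ _ (tendsto_mul hu hg₀.neg) fun n => ?_
      have hgu : u n - g n ∈ S.fil (k + 1) := by
        have := Submodule.sub_mem _ (S.mem_fil_succ (huk n)) (hg n)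
        rw [hsum] at this
        rwa [sub_sub_sub_cancel_right] at this
      have hlie : ⁅u n, -g n⁆ ∈ S.fil (k + 1) := by
        rw [← lie_skew]
        exact Submodule.neg_mem _ (S.lie_mem_fil_right _ (huk n))
      have := Submodule.add_mem _ (S.mul_sub_add_mem_fil hlie) hgu
      rwa [← sub_eq_add_neg, sub_add_cancel] at this
    have := hmul _ hrest _ hgP
    simpa [S.mul_assoc, S.neg_mul_self, S.mul_zero] using this

end Stratification


/-! ### Homogeneous distances and the vector space topology. -/

namespace HomogeneousDistance

section Algebra

variable {V : Type*} [LieRing V] [LieAlgebra ℝ V] {S : Stratification V}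
  (ρ : HomogeneousDistance S)

theorem dist_self (x : V) : ρ.dist x x = 0 := (ρ.dist_eq_zero x x).2 rfl

theorem dist_nonneg (x y : V) : 0 ≤ ρ.dist x y := by
  have := ρ.dist_triangle x y x
  rw [ρ.dist_self, ρ.dist_comm y x] at this
  linarith

theorem dist_pos {x y : V} (h : x ≠ y) : 0 < ρ.dist x y :=
  (ρ.dist_nonneg x y).lt_of_ne fun h' => h ((ρ.dist_eq_zero x y).1 h'.symm)

theorem dist_eq_dist_zero (x y : V) : ρ.dist x y = ρ.dist 0 (S.mul (-x) y) := by
  rw [← ρ.dist_mul_left (-x) x y, S.neg_mul_self]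

theorem dist_mul_right_eq (x u : V) : ρ.dist x (S.mul x u) = ρ.dist 0 u := by
  rw [dist_eq_dist_zero, S.neg_mul_cancel_left]

theorem dist_zero_neg (x : V) : ρ.dist 0 (-x) = ρ.dist 0 x := by
  rw [ρ.dist_comm 0 x, ρ.dist_eq_dist_zero x 0, S.mul_zero]

theorem dist_zero_mul_le (x y : V) : ρ.dist 0 (S.mul x y) ≤ ρ.dist 0 x + ρ.dist 0 y := by
  have := ρ.dist_triangle 0 x (S.mul x y)
  rwa [dist_mul_right_eq] at this

theorem dist_zero_dilation {t : ℝ} (ht : 0 < t) (x : V) :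
    ρ.dist 0 (S.dilation t x) = t * ρ.dist 0 x := by
  rw [← ρ.dist_dilation t ht, S.dilation_zero]

theorem dist_zero_smul {a : V} (ha : a ∈ S.layer 1) (c : ℝ) :
    ρ.dist 0 (c • a) = |c| * ρ.dist 0 a := by
  rcases lt_trichotomy c 0 with hc | rfl | hc
  · rw [abs_of_neg hc, ← dist_zero_neg, ← neg_smul,
      ← ρ.dist_zero_dilation (neg_pos.2 hc), S.dilation_of_mem ha, pow_one]
  · simp [dist_self]
  · rw [abs_of_pos hc, ← ρ.dist_zero_dilation hc, S.dilation_of_mem ha, pow_one]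

end Algebra

variable {V : Type*} [LieRing V] [LieAlgebra ℝ V] [FiniteDimensional ℝ V] [TopologicalSpace V]
  [IsTopologicalAddGroup V] [ContinuousSMul ℝ V] [T2Space V] {S : Stratification V}
  (ρ : HomogeneousDistance S) {ι : Type*} {F : Filter ι}

/-- Boundedness passes to products and inverses, and on horizontal lines `ρ(0, c a) = |c| ρ(0, a)`.
This is the starting point for the continuity of `ρ`. -/
theorem exists_eventually_dist_le {u : ι → V} {u₀ : V} (hu : Tendsto u F (𝓝 u₀)) :
    ∃ C, ∀ᶠ n in F, ρ.dist 0 (u n) ≤ C := by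
  refine S.mem_of_tendsto (P := {u | ∃ C, ∀ᶠ n in F, ρ.dist 0 (u n) ≤ C}) ?_ ?_ ?_ hu
  · rintro u ⟨C, hC⟩ w ⟨C', hC'⟩
    refine ⟨C + C', ?_⟩
    filter_upwards [hC, hC'] with n h h'
    exact (ρ.dist_zero_mul_le _ _).trans (add_le_add h h')
  · rintro u ⟨C, hC⟩
    exact ⟨C, by simpa only [dist_zero_neg] using hC⟩
  · intro a ha c c₀ hc
    refine ⟨(|c₀| + 1) * ρ.dist 0 a, ?_⟩
    filter_upwards [hc.abs.eventually_le_const (lt_add_one |c₀|)] with n hn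
    rw [ρ.dist_zero_smul ha]
    exact mul_le_mul_of_nonneg_right hn (ρ.dist_nonneg _ _)

/-- If `ρ(0, ·) ≤ C` near the origin, then `M ρ(0, u) = ρ(0, δ_M u) ≤ C` eventually for every fixed
`M > 0`. -/
theorem tendsto_dist_zero {u : ι → V} (hu : Tendsto u F (𝓝 0)) :
    Tendsto (fun n => ρ.dist 0 (u n)) F (𝓝 0) := by
  obtain ⟨C, hC⟩ := ρ.exists_eventually_dist_le (F := 𝓝 (0 : V)) (u := id) tendsto_id
  rw [Metric.tendsto_nhds]
  intro ε hε
  obtain ⟨M, hM⟩ := exists_gt (max 0 (C / ε))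
  have hM0 : 0 < M := (le_max_left _ _).trans_lt hM
  have hd := S.tendsto_dilation (tendsto_const_nhds (x := M)) hu
  rw [S.dilation_zero] at hd
  filter_upwards [hd.eventually hC] with n hn
  rw [id, ρ.dist_zero_dilation hM0] at hn
  rw [Real.dist_eq, sub_zero, abs_of_nonneg (ρ.dist_nonneg _ _)]
  have : C < M * ε := (div_lt_iff₀ hε).1 ((le_max_right _ _).trans_lt hM)
  exact lt_of_mul_lt_mul_left (hn.trans_lt this) hM0.le

theorem tendsto_dist {u v : ι → V} {u₀ v₀ : V} (hu : Tendsto u F (𝓝 u₀))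
    (hv : Tendsto v F (𝓝 v₀)) :
    Tendsto (fun n => ρ.dist (u n) (v n)) F (𝓝 (ρ.dist u₀ v₀)) := by
  have h : ∀ {u : ι → V} {u₀ : V}, Tendsto u F (𝓝 u₀) →
      Tendsto (fun n => ρ.dist (u n) u₀) F (𝓝 0) := by
    intro u u₀ hu
    have h1 := S.tendsto_mul hu.neg (tendsto_const_nhds (x := u₀))
    rw [S.neg_mul_self] at h1
    simpa only [← dist_eq_dist_zero] using ρ.tendsto_dist_zero h1
  rw [tendsto_iff_dist_tendsto_zero]
  have h0 := (h hu).add (h hv)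
  rw [add_zero] at h0
  refine squeeze_zero (fun _ => _root_.dist_nonneg) (fun n => ?_) h0
  rw [Real.dist_eq, abs_le]
  have h1 := ρ.dist_triangle (u n) u₀ (v n)
  have h2 := ρ.dist_triangle u₀ v₀ (v n)
  have h3 := ρ.dist_triangle u₀ (u n) v₀
  have h4 := ρ.dist_triangle (u n) (v n) v₀
  rw [ρ.dist_comm v₀ (v n)] at h2
  rw [ρ.dist_comm u₀ (u n)] at h3
  constructor <;> linarith

theorem continuous_dist_zero : Continuous (ρ.dist 0) :=
  continuous_iff_continuousAt.2 fun _ => ρ.tendsto_dist tendsto_const_nhds tendsto_id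

/-- The constant `c` is a positive lower bound of `ρ(0, ·)` on the compact sphere of radius `ε`. A
point outside the ball is brought to the sphere by a dilation with `t ≤ 1`, which does not increase
its distance from the origin. -/
theorem exists_pos_of_norm {n : ℕ} (e : V ≃L[ℝ] (Fin n → ℝ)) {ε : ℝ} (hε : 0 < ε) :
    ∃ c > 0, ∀ x, ρ.dist 0 x < c → ‖e x‖ < ε := by
  have hK : IsCompact (e.symm '' Metric.sphere 0 ε) :=
    (isCompact_sphere 0 ε).image e.symm.continuous
  obtain ⟨c, hc, hcK⟩ := hK.exists_forall_le' (a := 0) ρ.continuous_dist_zero.continuousOn (by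
    rintro _ ⟨y, hy, rfl⟩
    refine ρ.dist_pos fun h => ?_
    have : y = 0 := by simpa using congrArg e h.symm
    rw [this] at hy
    simp [hε.ne] at hy)
  refine ⟨c, hc, fun x hx => ?_⟩
  by_contra! hle
  have hcont : ContinuousOn (fun t => ‖e (S.dilation t x)‖) (Set.Icc 0 1) :=
    (continuous_norm.comp (e.continuous.comp
      (S.continuous_dilation.comp (continuous_id.prodMk continuous_const)))).continuousOn
  have hmem : ε ∈ Set.Icc (‖e (S.dilation 0 x)‖) (‖e (S.dilation 1 x)‖) := by
    rw [S.zero_dilation, S.dilation_one, map_zero, norm_zero]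
    exact ⟨hε.le, hle⟩
  obtain ⟨t, ht, hte⟩ := intermediate_value_Icc zero_le_one hcont hmem
  have ht0 : 0 < t := ht.1.lt_of_ne fun h => by
    simp only [← h, S.zero_dilation, map_zero, norm_zero] at hte
    exact hε.ne hte
  have h1 := hcK (S.dilation t x) ⟨e (S.dilation t x), by simpa using hte, by simp⟩
  rw [ρ.dist_zero_dilation ht0] at h1
  have h2 : t * ρ.dist 0 x ≤ 1 * ρ.dist 0 x :=
    mul_le_mul_of_nonneg_right ht.2 (ρ.dist_nonneg _ _)
  linarith

theorem tendsto_zero_of_dist {u : ι → V} (hu : Tendsto (fun n => ρ.dist 0 (u n)) F (𝓝 0)) :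
    Tendsto u F (𝓝 0) := by
  let e : V ≃L[ℝ] (Fin (Module.finrank ℝ V) → ℝ) :=
    (Module.finBasis ℝ V).equivFun.toContinuousLinearEquiv
  have h : Tendsto (fun n => e (u n)) F (𝓝 0) := by
    rw [tendsto_zero_iff_norm_tendsto_zero, Metric.tendsto_nhds]
    intro ε hε
    obtain ⟨c, hc, hce⟩ := ρ.exists_pos_of_norm e hε
    filter_upwards [hu.eventually_lt_const hc] with n hn
    simpa using hce _ hn
  simpa [Function.comp_def] using (e.symm.continuous.tendsto 0).comp h

theorem tendsto_of_dist {u v : ι → V} {u₀ : V} (hu : Tendsto u F (𝓝 u₀))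
    (hv : Tendsto (fun n => ρ.dist (u n) (v n)) F (𝓝 0)) : Tendsto v F (𝓝 u₀) := by
  simp only [ρ.dist_eq_dist_zero (u _)] at hv
  have := S.tendsto_mul hu (ρ.tendsto_zero_of_dist hv)
  simpa only [S.mul_neg_cancel_left, S.mul_zero] using this

/-- The dilation by `c / 2` maps the closed unit ball of `ρ` into a compact set, and dilating back
keeps compactness. -/
theorem exists_tendsto_of_dist_le (F : Ultrafilter ι) {u : ι → V}
    (hu : ∀ᶠ n in F, ρ.dist 0 (u n) ≤ 1) : ∃ u₀, Tendsto u F (𝓝 u₀) := by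
  let e : V ≃L[ℝ] (Fin (Module.finrank ℝ V) → ℝ) :=
    (Module.finBasis ℝ V).equivFun.toContinuousLinearEquiv
  obtain ⟨c, hc, hce⟩ := ρ.exists_pos_of_norm e one_pos
  have hK : IsCompact (e.symm '' Metric.closedBall 0 1) :=
    (isCompact_closedBall 0 1).image e.symm.continuous
  have hK' : IsCompact (S.dilation (c / 2)⁻¹ '' (e.symm '' Metric.closedBall 0 1)) :=
    hK.image (S.continuous_dilation.comp (continuous_const.prodMk continuous_id))
  have hmem : ∀ᶠ n in F, u n ∈ S.dilation (c / 2)⁻¹ '' (e.symm '' Metric.closedBall 0 1) := by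
    filter_upwards [hu] with n hn
    refine ⟨S.dilation (c / 2) (u n), ⟨e (S.dilation (c / 2) (u n)), ?_, by simp⟩,
      S.dilation_inv_dilation (by positivity) _⟩
    have : ρ.dist 0 (S.dilation (c / 2) (u n)) < c := by
      rw [ρ.dist_zero_dilation (by positivity)]
      have : c / 2 * ρ.dist 0 (u n) ≤ c / 2 * 1 := mul_le_mul_of_nonneg_left hn (by positivity)
      linarith
    simpa using (hce _ this).le
  obtain ⟨x, -, hx⟩ := hK'.ultrafilter_le_nhds (F.map u) (by
    rw [le_principal_iff]; exact hmem)
  exact ⟨x, hx⟩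

end HomogeneousDistance


/-! ### Convergence of endpoints of curves with nearly constant logarithmic derivative. -/

/-- Curves `Γ` with `Γ (t + h) = m (Γ t) (h X(t) + o(h))` starting at `0` end near `X₀` when `X` is
uniformly close to the constant `X₀`. Here `m` is a product whose components in a suitable
decomposition have triangular form, and for which `t ↦ t X₀` is a one-parameter group. -/
theorem tendsto_endpoint_of_curves {E : Type*} [NormedAddCommGroup E] [NormedSpace ℝ E]
    {m : E → E → E} (hm : ContDiff ℝ 1 fun x : E × E => m x.1 x.2)
    {s : ℕ} {π : ℕ → E →L[ℝ] E} (hsum : ∀ x, ∑ j ∈ Finset.range s, π j x = x)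
    (hπ : ∀ i j x, π i (π j x) = if i = j then π i x else 0)
    (htri : ∀ j g g' u, (∀ i < j, π i g = π i g') → π j (m g u) - π j g = π j (m g' u) - π j g')
    {ι : Type*} {F : Filter ι} {Γ X : ι → ℝ → E} {X₀ : E}
    (hX₀ : ∀ a b : ℝ, m (a • X₀) (b • X₀) = (a + b) • X₀) (hΓ0 : ∀ n, Γ n 0 = 0)
    (hΓ : ∀ᶠ n in F, ∀ t ∈ Set.Icc (0 : ℝ) 1, ∃ u : ℝ → E, u 0 = 0 ∧ HasDerivAt u (X n t) 0 ∧
      ∀ h, Γ n (t + h) = m (Γ n t) (u h))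
    (hX : Tendsto (fun x : ι × ℝ => X x.1 x.2) (F ×ˢ 𝓟 (Set.Icc 0 1)) (𝓝 X₀)) :
    Tendsto (fun n => Γ n 1) F (𝓝 X₀) := by
  -- the differential of `m g` at the origin
  let A : E → E →L[ℝ] E := fun g => (fderiv ℝ (fun x : E × E => m x.1 x.2) (g, 0)).comp
    (ContinuousLinearMap.inr ℝ E E)
  have hAcont : Continuous A :=
    ((hm.continuous_fderiv one_ne_zero).comp (continuous_id.prodMk continuous_const)).clm_comp
      continuous_const
  have hA : ∀ g, HasFDerivAt (m g) (A g) 0 := fun g =>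
    (hm.differentiable one_ne_zero (g, 0)).hasFDerivAt.comp (0 : E) (hasFDerivAt_prodMk_right g 0)
  have hAtri : ∀ j g g' x, (∀ i < j, π i g = π i g') → π j (A g x) = π j (A g' x) := by
    intro j g g' x h
    have h1 : HasFDerivAt (fun u => π j (m g u) - π j g) ((π j).comp (A g)) 0 :=
      ((π j).hasFDerivAt.comp (0 : E) (hA g)).sub_const _
    have h2 : HasFDerivAt (fun u => π j (m g' u) - π j g') ((π j).comp (A g')) 0 :=
      ((π j).hasFDerivAt.comp (0 : E) (hA g')).sub_const _
    have h3 : (fun u => π j (m g u) - π j g) = fun u => π j (m g' u) - π j g' :=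
      funext fun u => htri j g g' u h
    rw [h3] at h1
    exact congrArg (fun T : E →L[ℝ] E => T x) (h1.unique h2)
  have hAX₀ : ∀ t : ℝ, A (t • X₀) X₀ = X₀ := by
    intro t
    have h1 : HasDerivAt (fun b : ℝ => m (t • X₀) (b • X₀)) (A (t • X₀) X₀) 0 := by
      have h2 : HasDerivAt (fun b : ℝ => b • X₀) X₀ 0 := by
        simpa using (hasDerivAt_id (0 : ℝ)).smul_const X₀
      exact HasFDerivAt.comp_hasDerivAt_of_eq (0 : ℝ) (hA (t • X₀)) h2 (by simp)
    have h2 : HasDerivAt (fun b : ℝ => m (t • X₀) (b • X₀)) X₀ 0 := by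
      simp only [hX₀]
      simpa using ((hasDerivAt_id (0 : ℝ)).const_add t).smul_const X₀
    exact h1.unique h2
  have hderiv : ∀ᶠ n in F, ∀ t ∈ Set.Icc (0 : ℝ) 1,
      HasDerivAt (Γ n) (A (Γ n t) (X n t)) t := by
    filter_upwards [hΓ] with n hn t ht
    obtain ⟨u, hu0, hu, hΓu⟩ := hn t ht
    have h1 : HasDerivAt (fun h => Γ n (t + h)) (A (Γ n t) (X n t)) 0 := by
      simp only [hΓu]
      exact HasFDerivAt.comp_hasDerivAt_of_eq (0 : ℝ) (hA _) hu hu0.symm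
    have h2 := HasDerivAt.comp_sub_const (f := fun h => Γ n (t + h)) t t (by simpa using h1)
    simpa using h2
  -- component by component
  have key : ∀ j, Tendsto (fun x : ι × ℝ => π j (Γ x.1 x.2 - x.2 • X₀))
      (F ×ˢ 𝓟 (Set.Icc 0 1)) (𝓝 0) := by
    intro j
    induction j using Nat.strong_induction_on with
    | _ j ih =>
    have hdiff : Tendsto (fun x : ι × ℝ => π j (A (Γ x.1 x.2) (X x.1 x.2)) - π j X₀)
        (F ×ˢ 𝓟 (Set.Icc 0 1)) (𝓝 0) := by
      -- This `g` agrees with `Γ` in the components below `j`, the only ones that matter for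
      -- component `j` of the velocity, and it differs from `t X₀` by terms already known to tend to
      -- `0`.
      let g : ι × ℝ → E := fun x =>
        x.2 • X₀ + ∑ i ∈ Finset.range j, π i (Γ x.1 x.2 - x.2 • X₀)
      have hg : ∀ x : ι × ℝ, ∀ y, π j (A (Γ x.1 x.2) y) = π j (A (g x) y) := by
        intro x y
        refine hAtri j _ _ y fun i hi => ?_
        simp only [g, map_add, map_sum, hπ]
        rw [Finset.sum_ite_eq, if_pos (Finset.mem_range.2 hi), map_sub]
        abel
      simp only [hg]
      -- Along an ultrafilter the times in `[0, 1]` converge, so continuity of `A` at a single point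
      -- gives the uniform statement.
      rw [tendsto_iff_ultrafilter]
      intro G hG
      have hI : ∀ᶠ x : ι × ℝ in G, x.2 ∈ Set.Icc (0 : ℝ) 1 :=
        hG (tendsto_snd.eventually (mem_principal_self (Set.Icc (0 : ℝ) 1)))
      obtain ⟨t, -, ht⟩ := (isCompact_Icc (a := (0 : ℝ)) (b := 1)).ultrafilter_le_nhds
        (G.map Prod.snd) (by rw [le_principal_iff]; exact hI)
      have ht' : Tendsto (fun x : ι × ℝ => x.2) G (𝓝 t) := ht
      have hgt : Tendsto g G (𝓝 (t • X₀)) := by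
        have h1 : Tendsto (fun x : ι × ℝ => ∑ i ∈ Finset.range j, π i (Γ x.1 x.2 - x.2 • X₀)) G
            (𝓝 (∑ i ∈ Finset.range j, 0)) :=
          tendsto_finsetSum _ fun i hi => (ih i (Finset.mem_range.1 hi)).mono_left hG
        have h2 := (ht'.smul_const X₀).add h1
        rw [Finset.sum_const_zero, add_zero] at h2
        exact h2
      have h2 : Tendsto (fun x : ι × ℝ => A (g x) (X x.1 x.2)) G (𝓝 (A (t • X₀) X₀)) :=
        (isBoundedBilinearMap_apply.continuous.tendsto (A (t • X₀), X₀)).comp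
          (((hAcont.tendsto _).comp hgt).prodMk_nhds (hX.mono_left hG))
      have h3 := (((π j).continuous.tendsto _).comp h2).sub_const (π j X₀)
      rw [hAX₀, sub_self] at h3
      exact h3
    rw [Metric.tendsto_nhds] at hdiff ⊢
    intro ε hε
    have h1 := hdiff (ε / 2) (half_pos hε)
    rw [eventually_prod_principal_iff] at h1 ⊢
    filter_upwards [h1, hderiv] with n hn hd t ht
    -- The mean value inequality on `[0, 1]` for the error in component `j`, which vanishes at `t =
    -- 0`.
    have hb := Convex.norm_image_sub_le_of_norm_hasDerivWithin_le (𝕜 := ℝ)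
      (f := fun t => π j (Γ n t - t • X₀))
      (f' := fun t => π j (A (Γ n t) (X n t)) - π j X₀) (s := Set.Icc 0 1) (x := 0) (y := t)
      (C := ε / 2) (fun t ht => by
        have h2 : HasDerivAt (fun t : ℝ => Γ n t - t • X₀) (A (Γ n t) (X n t) - X₀) t := by
          have := (hd t ht).fun_sub ((hasDerivAt_id t).smul_const X₀)
          simpa using this
        have h3 := (π j).hasFDerivAt.comp_hasDerivAt t h2
        rw [map_sub] at h3
        exact h3.hasDerivWithinAt)
      (fun t ht => by simpa using (hn t ht).le) (convex_Icc 0 1) (by simp) ht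
    simp only [hΓ0, zero_smul, sub_zero, map_zero] at hb
    rw [dist_zero_right]
    refine hb.trans_lt ?_
    have : ‖t‖ ≤ 1 := by rw [Real.norm_eq_abs, abs_of_nonneg ht.1]; exact ht.2
    nlinarith
  have hone : Tendsto (fun n => ((n, 1) : ι × ℝ)) F (F ×ˢ 𝓟 (Set.Icc 0 1)) :=
    tendsto_id.prodMk (tendsto_principal.2 (Eventually.of_forall fun _ => by simp))
  have h1 : Tendsto (fun n => ∑ j ∈ Finset.range s, π j (Γ n 1 - (1 : ℝ) • X₀)) F
      (𝓝 (∑ j ∈ Finset.range s, 0)) :=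
    tendsto_finsetSum _ fun j _ => (key j).comp hone
  simp only [hsum, one_smul, Finset.sum_const_zero] at h1
  simpa using h1.add_const X₀


/-! ### The product in linear coordinates and the endpoint lemma in the group. -/

namespace Stratification

variable {V : Type*} [LieRing V] [LieAlgebra ℝ V]

section Coordinates

variable {κ : Type*} [Fintype κ] (b : Module.Basis κ ℝ V)

theorem contDiff_lie_coordinates :
    ContDiff ℝ 1 fun x : (κ → ℝ) × (κ → ℝ) =>
      b.equivFun ⁅b.equivFun.symm x.1, b.equivFun.symm x.2⁆ := by
  have h : ∀ x : (κ → ℝ) × (κ → ℝ), b.equivFun ⁅b.equivFun.symm x.1, b.equivFun.symm x.2⁆ =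
      ∑ i, ∑ j, (x.1 i * x.2 j) • b.equivFun ⁅b i, b j⁆ := by
    intro x
    rw [b.equivFun_symm_apply, b.equivFun_symm_apply, sum_lie_sum]
    simp only [map_sum, smul_lie, lie_smul, smul_smul, map_smul, mul_comm]
  simp only [h]
  refine ContDiff.sum fun i _ => ContDiff.sum fun j _ => ?_
  fun_prop

theorem contDiff_nestedBracket_coordinates (l : List Bool) :
    ContDiff ℝ 1 fun x : (κ → ℝ) × (κ → ℝ) => b.equivFun
      (nestedBracket (l.map fun c => cond c (b.equivFun.symm x.1) (b.equivFun.symm x.2))) := by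
  have hc : ∀ c, ContDiff ℝ 1 fun x : (κ → ℝ) × (κ → ℝ) =>
      b.equivFun (cond c (b.equivFun.symm x.1) (b.equivFun.symm x.2)) := by
    intro c; cases c
    · simpa only [cond_false, LinearEquiv.apply_symm_apply] using contDiff_snd
    · simpa only [cond_true, LinearEquiv.apply_symm_apply] using contDiff_fst
  induction l with
  | nil => simpa [nestedBracket] using contDiff_const
  | cons c l ih =>
    rcases l with _ | ⟨d, l⟩
    · exact hc c
    · have := (contDiff_lie_coordinates b).comp ((hc c).prodMk ih)
      simpa only [Function.comp_def, LinearEquiv.symm_apply_apply, List.map_cons,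
        nestedBracket] using this

theorem contDiff_mul_coordinates (S : Stratification V) :
    ContDiff ℝ 1 fun x : (κ → ℝ) × (κ → ℝ) =>
      b.equivFun (S.mul (b.equivFun.symm x.1) (b.equivFun.symm x.2)) := by
  simp only [S.mul_eq_dynkin le_rfl, dynkin, map_sum, map_smul]
  refine ContDiff.sum fun n _ => ContDiff.const_smul _ (ContDiff.sum fun w _ => ?_)
  exact ContDiff.const_smul _ (contDiff_nestedBracket_coordinates b _)

end Coordinates

variable [FiniteDimensional ℝ V] [TopologicalSpace V]
  [IsTopologicalAddGroup V] [ContinuousSMul ℝ V] [T2Space V] (S : Stratification V)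

/-- In linear coordinates the product is `C^1`, and `proj_mul_sub` gives its triangular form, so
`tendsto_endpoint_of_curves` applies. -/
theorem tendsto_endpoint {ι : Type*} {F : Filter ι} {Γ X : ι → ℝ → V} {X₀ : V}
    (hΓ0 : ∀ n, Γ n 0 = 0)
    (hΓ : ∀ᶠ n in F, ∀ t ∈ Set.Icc (0 : ℝ) 1,
      Tendsto (fun h : ℝ => h⁻¹ • S.mul (-Γ n t) (Γ n (t + h))) (𝓝[≠] 0) (𝓝 (X n t)))
    (hX : Tendsto (fun x : ι × ℝ => X x.1 x.2) (F ×ˢ 𝓟 (Set.Icc 0 1)) (𝓝 X₀)) :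
    Tendsto (fun n => Γ n 1) F (𝓝 X₀) := by
  let b := Module.finBasis ℝ V
  let e : V ≃L[ℝ] (Fin (Module.finrank ℝ V) → ℝ) := b.equivFun.toContinuousLinearEquiv
  have hes : ∀ v, e.symm (e v) = v := e.symm_apply_apply
  let π : ℕ → (Fin (Module.finrank ℝ V) → ℝ) →L[ℝ] (Fin (Module.finrank ℝ V) → ℝ) := fun j =>
    LinearMap.toContinuousLinearMap
      ((e.toLinearEquiv : V →ₗ[ℝ] _) ∘ₗ S.proj j ∘ₗ (e.symm.toLinearEquiv : _ →ₗ[ℝ] V))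
  have hπ : ∀ j x, π j x = e (S.proj j (e.symm x)) := fun j x => rfl
  have key := tendsto_endpoint_of_curves (m := fun x y => e (S.mul (e.symm x) (e.symm y)))
    (contDiff_mul_coordinates b S) (s := S.step + 1) (π := π)
    (fun x => by simp only [hπ, ← map_sum, S.sum_proj, e.apply_symm_apply])
    (fun i j x => by
      simp only [hπ, hes, S.proj_proj]
      split_ifs <;> simp)
    (fun j g g' u h => by
      simp only [hπ, hes, ← map_sub]
      congr 1
      rw [map_sub, map_sub]
      exact S.proj_mul_sub (fun i hi => e.injective (h i hi)) _)
    (F := F) (Γ := fun n t => e (Γ n t)) (X := fun n t => e (X n t)) (X₀ := e X₀)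
    (fun a c => by
      rw [← map_smul, ← map_smul, hes, hes, S.smul_mul_smul, map_smul])
    (fun n => by rw [hΓ0, map_zero])
    (by
      filter_upwards [hΓ] with n hn t ht
      refine ⟨fun h => e (S.mul (-Γ n t) (Γ n (t + h))), by simp [S.neg_mul_self], ?_, fun h => ?_⟩
      · rw [hasDerivAt_iff_tendsto_slope_zero]
        have := (e.continuous.tendsto _).comp (hn t ht)
        simpa [Function.comp_def, S.neg_mul_self] using this
      · rw [hes, hes, S.mul_neg_cancel_left])
    ((e.continuous.tendsto _).comp hX)
  simpa [Function.comp_def, hes] using (e.symm.continuous.tendsto _).comp key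

end Stratification


/-! ### From continuous Pansu differentials to strict differentiability. -/

section

variable {V : Type*} [LieRing V] [LieAlgebra ℝ V] {S : Stratification V}
  {V' : Type*} [LieRing V'] [LieAlgebra ℝ V'] [FiniteDimensional ℝ V'] [TopologicalSpace V']
  [IsTopologicalAddGroup V'] [ContinuousSMul ℝ V'] [T2Space V'] {S' : Stratification V'}
  {ρ : HomogeneousDistance S} {ρ' : HomogeneousDistance S'}

theorem tendsto_apply_of_homDist {ι : Type*} {F : Filter ι} {D : ι → HomogeneousHom S S'}
    {L : HomogeneousHom S S'} (h : Tendsto (fun n => homDist ρ ρ' (D n) L) F (𝓝 0)) (a : V) :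
    Tendsto (fun n => (D n).toLieHom a) F (𝓝 (L.toLieHom a)) := by
  rcases eq_or_ne a 0 with rfl | ha
  · simp only [map_zero]
    exact tendsto_const_nhds
  have hpos : 0 < ρ.dist 0 a := ρ.dist_pos (Ne.symm ha)
  have h1 : Tendsto (fun n => ENNReal.ofReal
      (ρ'.dist ((D n).toLieHom a) (L.toLieHom a) / ρ.dist 0 a)) F (𝓝 0) :=
    tendsto_of_tendsto_of_tendsto_of_le_of_le tendsto_const_nhds h (fun _ => zero_le)
      fun n => le_iSup₂ (f := fun (v : V) (_ : v ≠ 0) => ENNReal.ofReal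
        (ρ'.dist ((D n).toLieHom v) (L.toLieHom v) / ρ.dist 0 v)) a ha
  have h2 := ((ENNReal.tendsto_toReal ENNReal.zero_ne_top).comp h1).mul_const (ρ.dist 0 a)
  refine ρ'.tendsto_of_dist (u := fun _ => L.toLieHom a) tendsto_const_nhds ?_
  rw [ENNReal.toReal_zero, MulZeroClass.zero_mul] at h2
  refine h2.congr fun n => ?_
  rw [Function.comp_apply, ENNReal.toReal_ofReal (div_nonneg (ρ'.dist_nonneg _ _) hpos.le),
    div_mul_cancel₀ _ hpos.ne', ρ'.dist_comm]

end

section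

variable {V : Type*} [LieRing V] [LieAlgebra ℝ V] [FiniteDimensional ℝ V] [TopologicalSpace V]
  [IsTopologicalAddGroup V] [ContinuousSMul ℝ V] [T2Space V] {S : Stratification V}

namespace Stratification

/-- Layer `j` carries the factor `k ^ (j - 1)`, so only the horizontal part survives. This converts
limits of dilated increments into ordinary derivatives. The truncated subtraction at `j = 0` is
harmless, as layer `0` is trivial. -/
theorem tendsto_inv_smul_dilation {ι : Type*} {F : Filter ι} {k : ι → ℝ} {Z : ι → V} {z : V}
    (hz : z ∈ S.layer 1) (hk : Tendsto k F (𝓝[≠] 0)) (hZ : Tendsto Z F (𝓝 z)) :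
    Tendsto (fun n => (k n)⁻¹ • S.dilation (k n) (Z n)) F (𝓝 z) := by
  rw [tendsto_nhdsWithin_iff] at hk
  have h1 : Tendsto (fun n => ∑ j ∈ Finset.range (S.step + 1), (k n) ^ (j - 1) • S.proj j (Z n)) F
      (𝓝 (∑ j ∈ Finset.range (S.step + 1), (0 : ℝ) ^ (j - 1) • S.proj j z)) :=
    tendsto_finsetSum _ fun j _ =>
      (hk.1.pow (j - 1)).smul (((S.continuous_proj j).tendsto z).comp hZ)
  have h2 : ∑ j ∈ Finset.range (S.step + 1), (0 : ℝ) ^ (j - 1) • S.proj j z = z := by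
    conv_rhs => rw [← S.sum_proj z]
    refine Finset.sum_congr rfl fun j _ => ?_
    by_cases hj : j = 1
    · simp [hj]
    · rw [S.proj_of_mem_ne hz (Ne.symm hj), smul_zero]
  rw [h2] at h1
  refine h1.congr' ?_
  filter_upwards [hk.2] with n hn
  rw [S.dilation_eq_sum, Finset.smul_sum]
  refine Finset.sum_congr rfl fun j _ => ?_
  rcases j with _ | j
  · simp [S.proj_zero_apply]
  · rw [smul_smul, pow_succ', inv_mul_cancel_left₀ hn, Nat.add_sub_cancel]

end Stratification

theorem HomogeneousDistance.exists_dist_lt_imp_mem (ρ : HomogeneousDistance S) {p : V} {s : Set V}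
    (hs : s ∈ 𝓝 p) : ∃ ε > 0, ∀ x, ρ.dist p x < ε → x ∈ s := by
  have h := ρ.tendsto_of_dist (F := comap (ρ.dist p) (𝓝 0)) (v := id)
    (tendsto_const_nhds (x := p)) tendsto_comap
  obtain ⟨t, ht, hts⟩ := mem_comap.1 (h hs)
  obtain ⟨ε, hε, hεt⟩ := Metric.mem_nhds_iff.1 ht
  refine ⟨ε, hε, fun x hx => hts (hεt ?_)⟩
  rwa [Metric.mem_ball, Real.dist_eq, sub_zero, abs_of_nonneg (ρ.dist_nonneg _ _)]

variable {V' : Type*} [LieRing V'] [LieAlgebra ℝ V'] [FiniteDimensional ℝ V'] [TopologicalSpace V']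
  [IsTopologicalAddGroup V'] [ContinuousSMul ℝ V'] [T2Space V'] {S' : Stratification V'}
  {ρ : HomogeneousDistance S} {ρ' : HomogeneousDistance S'} {Ω : Set V} {f : V → V'}

/-- One-sided derivative of a Pansu differentiable map along a horizontal line. -/
theorem HasPansuDifferentialAt.tendsto_horizontal_aux {L : HomogeneousHom S S'} {q : V}
    (hf : HasPansuDifferentialAt ρ ρ' Ω f L q) (hΩ : Ω ∈ 𝓝 q) {v : V} (hv : v ∈ S.layer 1)
    (hv0 : v ≠ 0) {s : ℝ} (hs : 0 < s) {G : Filter ℝ} (hG : G ≤ 𝓝[≠] 0) {σ : ℝ}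
    (hσ : ∀ᶠ h in G, h = σ * |h|) (hσ2 : σ * σ = 1) :
    Tendsto (fun h : ℝ => h⁻¹ • S'.dilation s (S'.mul (-f q) (f (S.mul q (h • v))))) G
      (𝓝 (s • L.toLieHom v)) := by
  have hne : ∀ᶠ h in G, h ≠ 0 := hG self_mem_nhdsWithin
  have hid : Tendsto (fun h : ℝ => h) G (𝓝 0) := hG.trans nhdsWithin_le_nhds
  set w : ℝ → V' := fun h => S'.mul (-f q) (f (S.mul q (h • v))) with hw
  have hLv : L.toLieHom v ∈ S'.layer 1 := L.map_layer 1 v hv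
  have hx : Tendsto (fun h : ℝ => S.mul q (h • v)) G (𝓝[Ω \ {q}] q) := by
    have h1 : Tendsto (fun h : ℝ => S.mul q (h • v)) G (𝓝 q) := by
      have := S.tendsto_mul (tendsto_const_nhds (x := q)) (hid.smul_const v)
      rwa [zero_smul, S.mul_zero] at this
    rw [tendsto_nhdsWithin_iff]
    refine ⟨h1, ?_⟩
    filter_upwards [h1 hΩ, hne] with h hh h0
    refine ⟨hh, fun hq => ?_⟩
    have := congrArg (S.mul (-q)) (Set.mem_singleton_iff.1 hq)
    rw [S.neg_mul_cancel_left, S.neg_mul_self, smul_eq_zero] at this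
    exact this.elim h0 hv0
  have hlim := (Tendsto.comp hf hx).mul_const (ρ.dist 0 v)
  rw [MulZeroClass.zero_mul] at hlim
  have hpos : 0 < ρ.dist 0 v := ρ.dist_pos (Ne.symm hv0)
  -- Distances scale only under dilations with positive parameter, so `h` is written `σ |h|`, with
  -- `σ` its sign along `G`.
  have hZ : Tendsto (fun h => S'.dilation |h|⁻¹ (w h)) G (𝓝 (σ • L.toLieHom v)) := by
    refine ρ'.tendsto_of_dist (u := fun _ => σ • L.toLieHom v) tendsto_const_nhds ?_
    refine hlim.congr' ?_
    filter_upwards [hσ, hne] with h hh h0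
    have habs : 0 < |h| := abs_pos.2 h0
    have e1 : σ • L.toLieHom v = S'.dilation |h|⁻¹ (L.toLieHom (h • v)) := by
      rw [map_smul, S'.dilation_of_mem ((S'.layer 1).smul_mem _ hLv), pow_one, smul_smul]
      congr 1
      field_simp
      linarith
    rw [e1, ρ'.dist_dilation _ (inv_pos.2 habs), ρ'.dist_comm]
    simp only [Function.comp_def]
    rw [S.neg_mul_cancel_left, ρ.dist_mul_right_eq, ρ.dist_zero_smul hv]
    field_simp
    rfl
  have hk : Tendsto (fun h : ℝ => s * |h|) G (𝓝[≠] 0) := by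
    rw [tendsto_nhdsWithin_iff]
    refine ⟨by simpa using hid.abs.const_mul s, ?_⟩
    filter_upwards [hne] with h h0
    exact (mul_pos hs (abs_pos.2 h0)).ne'
  have h1 := (S'.tendsto_inv_smul_dilation ((S'.layer 1).smul_mem σ hLv) hk hZ).const_smul (σ * s)
  rw [smul_smul, mul_right_comm, hσ2, one_mul] at h1
  refine h1.congr' ?_
  filter_upwards [hσ, hne] with h hh h0
  have habs : |h| ≠ 0 := abs_ne_zero.2 h0
  rw [S'.dilation_dilation, mul_assoc, mul_inv_cancel₀ habs, mul_one, smul_smul]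
  congr 1
  have hσ0 : σ ≠ 0 := fun h => by simp [h] at hσ2
  have hs0 := hs.ne'
  rw [mul_inv, mul_assoc, mul_inv_cancel_left₀ hs0]
  have : h⁻¹ = σ⁻¹ * |h|⁻¹ := by rw [← mul_inv, ← hh]
  rw [this, inv_eq_of_mul_eq_one_right hσ2]

theorem HasPansuDifferentialAt.tendsto_horizontal {L : HomogeneousHom S S'} {q : V}
    (hf : HasPansuDifferentialAt ρ ρ' Ω f L q) (hΩ : Ω ∈ 𝓝 q) {v : V} (hv : v ∈ S.layer 1)
    {s : ℝ} (hs : 0 < s) :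
    Tendsto (fun h : ℝ => h⁻¹ • S'.dilation s (S'.mul (-f q) (f (S.mul q (h • v))))) (𝓝[≠] 0)
      (𝓝 (s • L.toLieHom v)) := by
  rcases eq_or_ne v 0 with rfl | hv0
  · simp [S.mul_zero, S'.neg_mul_self, S'.dilation_zero]
  have hle : 𝓝[≠] (0 : ℝ) = 𝓝[<] 0 ⊔ 𝓝[>] 0 := by
    rw [← nhdsWithin_union, Set.Iio_union_Ioi]
  have hneg := hf.tendsto_horizontal_aux hΩ hv hv0 hs (G := 𝓝[<] 0) (σ := -1)
    (hle ▸ le_sup_left) (by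
      filter_upwards [self_mem_nhdsWithin] with h hh
      rw [abs_of_neg hh]; ring) (by norm_num)
  have hpos := hf.tendsto_horizontal_aux hΩ hv hv0 hs (G := 𝓝[>] 0) (σ := 1)
    (hle ▸ le_sup_right) (by
      filter_upwards [self_mem_nhdsWithin] with h hh
      rw [abs_of_pos hh]; ring) (by norm_num)
  rw [hle]
  exact hneg.sup hpos

/-- The rescaled image `Γ` of the segment `γ` from `y` to `y δ_r (c a)` starts at `0`, and its left
logarithmic derivative at time `t` is `c D(γ t) a`. Continuity of `D` at `p` makes this uniformly
close to `D p (c₀ a)`, since all the segments shrink to `p`. -/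
theorem tendsto_increment_horizontal
    (hΩ : IsOpen Ω) {D : V → HomogeneousHom S S'}
    (hD : ∀ p ∈ Ω, HasPansuDifferentialAt ρ ρ' Ω f (D p) p) {p : V} (hp : p ∈ Ω)
    (hDp : Tendsto (fun q => homDist ρ ρ' (D q) (D p)) (𝓝[Ω] p) (𝓝 0))
    {ι : Type*} {F : Filter ι} {r : ι → ℝ} (hr : Tendsto r F (𝓝[>] 0))
    {y : ι → V} (hy : Tendsto y F (𝓝 p)) {a : V}
    (ha : a ∈ S.layer 1) {c : ι → ℝ} {c₀ : ℝ} (hc : Tendsto c F (𝓝 c₀)) :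
    Tendsto (fun n => S'.dilation (r n)⁻¹ (S'.mul (-f (y n))
      (f (S.mul (y n) (S.dilation (r n) (c n • a)))))) F (𝓝 ((D p).toLieHom (c₀ • a))) := by
  have hr' := tendsto_nhdsWithin_iff.1 hr
  let γ : ι → ℝ → V := fun n t => S.mul (y n) ((t * (r n * c n)) • a)
  let Γ : ι → ℝ → V' := fun n t => S'.dilation (r n)⁻¹ (S'.mul (-f (y n)) (f (γ n t)))
  have hγ : Tendsto (fun x : ι × ℝ => γ x.1 x.2) (F ×ˢ 𝓟 (Set.Icc 0 1)) (𝓝 p) := by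
    have h1 : Tendsto (fun x : ι × ℝ => x.2 * (r x.1 * c x.1)) (F ×ˢ 𝓟 (Set.Icc 0 1)) (𝓝 0) := by
      have h2 : Tendsto (fun x : ι × ℝ => |r x.1 * c x.1|) (F ×ˢ 𝓟 (Set.Icc 0 1)) (𝓝 0) := by
        have := ((hr'.1.mul hc).abs).comp (tendsto_fst (f := F) (g := 𝓟 (Set.Icc (0 : ℝ) 1)))
        simpa [Function.comp_def] using this
      refine squeeze_zero_norm' ?_ h2
      filter_upwards [tendsto_snd.eventually (mem_principal_self (Set.Icc (0 : ℝ) 1))] with x hx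
      rw [norm_mul, Real.norm_eq_abs, Real.norm_eq_abs, abs_of_nonneg hx.1]
      exact mul_le_of_le_one_left (abs_nonneg _) hx.2
    have h2 := S.tendsto_mul (hy.comp tendsto_fst) (h1.smul_const a)
    rwa [zero_smul, S.mul_zero] at h2
  have hγΩ : ∀ᶠ x in F ×ˢ 𝓟 (Set.Icc (0 : ℝ) 1), γ x.1 x.2 ∈ Ω := hγ (hΩ.mem_nhds hp)
  have key := S'.tendsto_endpoint (F := F) (Γ := Γ)
    (X := fun n t => c n • (D (γ n t)).toLieHom a) (X₀ := (D p).toLieHom (c₀ • a))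
    (fun n => by simp [Γ, γ, S.mul_zero, S'.neg_mul_self, S'.dilation_zero])
    (by
      rw [eventually_prod_principal_iff] at hγΩ
      filter_upwards [hγΩ, hr'.2] with n hn hrn t ht
      have hrn : 0 < r n := hrn
      have h1 := (hD _ (hn t ht)).tendsto_horizontal (hΩ.mem_nhds (hn t ht))
        ((S.layer 1).smul_mem (r n * c n) ha) (inv_pos.2 hrn)
      rw [map_smul, smul_smul, inv_mul_cancel_left₀ hrn.ne'] at h1
      refine h1.congr fun h => ?_
      congr 1
      have e1 : S.mul (γ n t) (h • (r n * c n) • a) = γ n (t + h) := by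
        simp only [γ]
        rw [S.mul_assoc, smul_smul, S.smul_mul_smul, add_mul]
      rw [e1, ← S'.dilation_neg, S'.neg_mul_rev, neg_neg, ← S'.dilation_mul,
        S'.neg_mul_mul_neg_mul])
    (by
      rw [map_smul]
      refine Tendsto.smul (hc.comp tendsto_fst) (tendsto_apply_of_homDist (hDp.comp ?_) a)
      exact tendsto_nhdsWithin_iff.2 ⟨hγ, hγΩ⟩)
  refine key.congr fun n => ?_
  simp only [Γ, γ]
  rw [S.dilation_of_mem ((S.layer 1).smul_mem _ ha), pow_one, smul_smul, one_mul]

theorem tendsto_increment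
    (hΩ : IsOpen Ω) {D : V → HomogeneousHom S S'}
    (hD : ∀ p ∈ Ω, HasPansuDifferentialAt ρ ρ' Ω f (D p) p) {p : V} (hp : p ∈ Ω)
    (hDp : Tendsto (fun q => homDist ρ ρ' (D q) (D p)) (𝓝[Ω] p) (𝓝 0))
    {ι : Type*} {F : Filter ι} {r : ι → ℝ} (hr : Tendsto r F (𝓝[>] 0))
    [F.NeBot] {y : ι → V} (hy : Tendsto y F (𝓝 p)) {u : ι → V} {u₀ : V}
    (hu : Tendsto u F (𝓝 u₀)) :
    Tendsto (fun n => S'.dilation (r n)⁻¹ (S'.mul (-f (y n))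
      (f (S.mul (y n) (S.dilation (r n) (u n)))))) F (𝓝 ((D p).toLieHom u₀)) := by
  have hr' := tendsto_nhdsWithin_iff.1 hr
  have hstep : ∀ {y u : ι → V} {u₀ : V}, Tendsto y F (𝓝 p) → Tendsto u F (𝓝 u₀) →
      Tendsto (fun n => S.mul (y n) (S.dilation (r n) (u n))) F (𝓝 p) := by
    intro y u u₀ hy hu
    have := S.tendsto_mul hy (S.tendsto_dilation hr'.1 hu)
    rwa [S.zero_dilation, S.mul_zero] at this
  -- Allowing all base points tending to `p` makes the class closed under products and inverses: the
  -- second factor is measured from `y δ_r u`, and the inverse from `y δ_r u⁻¹`.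
  have key := S.mem_of_tendsto (F := F) (P := {u | ∃ u₀, Tendsto u F (𝓝 u₀) ∧
    ∀ y : ι → V, Tendsto y F (𝓝 p) → Tendsto (fun n => S'.dilation (r n)⁻¹ (S'.mul (-f (y n))
      (f (S.mul (y n) (S.dilation (r n) (u n)))))) F (𝓝 ((D p).toLieHom u₀))}) ?_ ?_ ?_ hu
  · obtain ⟨u₁, hu₁, h⟩ := key
    rw [tendsto_nhds_unique hu hu₁]
    exact h y hy
  · rintro u ⟨u₀, hu, h⟩ w ⟨w₀, hw, h'⟩
    refine ⟨_, S.tendsto_mul hu hw, fun y hy => ?_⟩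
    rw [(D p).map_mul]
    refine (S'.tendsto_mul (h y hy) (h' _ (hstep hy hu))).congr fun n => ?_
    rw [← S'.dilation_mul, S'.neg_mul_mul_neg_mul, S.dilation_mul, S.mul_assoc]
  · rintro u ⟨u₀, hu, h⟩
    refine ⟨_, hu.neg, fun y hy => ?_⟩
    rw [map_neg]
    refine (h _ (hstep hy hu.neg)).neg.congr fun n => ?_
    rw [S.mul_assoc, S.dilation_neg, S.neg_mul_self, S.mul_zero, ← S'.dilation_neg,
      S'.neg_mul_rev, neg_neg]
  · intro a ha c c₀ hc
    exact ⟨_, hc.smul_const a, fun y hy =>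
      tendsto_increment_horizontal hΩ hD hp hDp hr hy ha hc⟩

/-- Blow-up at scale `r = ρ(x, y)`: the rescaled displacement `δ_{1/r}(y⁻¹ x)` has distance `1` from
the origin, hence converges along the ultrafilter. Both the rescaled increment of `f` and the image
of the displacement under `D p` tend to the same point, and by homogeneity the quotient is the
distance between them. -/
theorem tendsto_strict_quotient (hΩ : IsOpen Ω) {D : V → HomogeneousHom S S'}
    (hD : ∀ p ∈ Ω, HasPansuDifferentialAt ρ ρ' Ω f (D p) p) {p : V} (hp : p ∈ Ω)
    (hDp : Tendsto (fun q => homDist ρ ρ' (D q) (D p)) (𝓝[Ω] p) (𝓝 0)) :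
    Tendsto (fun z : V × V => ρ'.dist (S'.mul (-f z.2) (f z.1))
      ((D p).toLieHom (S.mul (-z.2) z.1)) / ρ.dist z.1 z.2)
      (𝓝 (p, p) ⊓ 𝓟 {z | z.1 ≠ z.2}) (𝓝 0) := by
  rw [tendsto_iff_ultrafilter]
  intro G hG
  have hG1 : Tendsto (fun z : V × V => z) G (𝓝 (p, p)) := hG.trans inf_le_left
  have hne : ∀ᶠ z : V × V in G, z.1 ≠ z.2 := hG.trans inf_le_right (mem_principal_self _)
  have hx : Tendsto (fun z : V × V => z.1) G (𝓝 p) := (continuous_fst.tendsto (p, p)).comp hG1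
  have hy : Tendsto (fun z : V × V => z.2) G (𝓝 p) := (continuous_snd.tendsto (p, p)).comp hG1
  have hr : Tendsto (fun z : V × V => ρ.dist z.1 z.2) G (𝓝[>] 0) := by
    rw [tendsto_nhdsWithin_iff]
    refine ⟨ρ.dist_self p ▸ ρ.tendsto_dist hx hy, ?_⟩
    filter_upwards [hne] with z hz using ρ.dist_pos hz
  obtain ⟨u₀, hu₀⟩ := ρ.exists_tendsto_of_dist_le G
    (u := fun z => S.dilation (ρ.dist z.1 z.2)⁻¹ (S.mul (-z.2) z.1)) (by
      filter_upwards [hne] with z hz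
      have hpos := ρ.dist_pos hz
      rw [ρ.dist_zero_dilation (inv_pos.2 hpos), ← ρ.dist_eq_dist_zero, ρ.dist_comm z.2,
        inv_mul_cancel₀ hpos.ne'])
  have h1 := tendsto_increment hΩ hD hp hDp hr hy hu₀
  have hL : Continuous (D p).toLieHom :=
    LinearMap.continuous_of_finiteDimensional ((D p).toLieHom : V →ₗ[ℝ] V')
  have h2 := ρ'.tendsto_dist h1 ((hL.tendsto u₀).comp hu₀)
  rw [ρ'.dist_self] at h2
  refine h2.congr' ?_
  filter_upwards [hne] with z hz
  have hpos := ρ.dist_pos hz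
  rw [S.dilation_dilation_inv hpos.ne', S.mul_neg_cancel_left, Function.comp_apply,
    (D p).map_dilation, ρ'.dist_dilation _ (inv_pos.2 hpos), ← div_eq_inv_mul]

theorem IsC1H.isStrictlyPansuDifferentiableAt (hΩ : IsOpen Ω) (hf : IsC1H ρ ρ' Ω f) {p : V}
    (hp : p ∈ Ω) : IsStrictlyPansuDifferentiableAt ρ ρ' Ω f p := by
  obtain ⟨D, hD, hDc⟩ := hf
  refine ⟨D p, ?_⟩
  have hQ := tendsto_strict_quotient hΩ hD hp (hDc p hp)
  rw [ENNReal.tendsto_nhds_zero]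
  intro η hη
  rcases eq_or_ne η ⊤ with rfl | hη'
  · exact Eventually.of_forall fun _ => le_top
  have hη0 : 0 < η.toReal := ENNReal.toReal_pos hη.ne' hη'
  have hev := eventually_inf_principal.1 (hQ.eventually_lt_const hη0)
  obtain ⟨s, hs, t, ht, hst⟩ := mem_nhds_prod_iff.1 hev
  obtain ⟨ε, hε, hεs⟩ := ρ.exists_dist_lt_imp_mem (inter_mem hs ht)
  filter_upwards [Ioo_mem_nhdsGT hε] with δ hδ
  refine iSup_le fun x => iSup_le fun y => iSup_le fun h => ?_
  refine ENNReal.ofReal_le_of_le_toReal (le_of_lt ?_)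
  have hxy : (x, y) ∈ s ×ˢ t :=
    ⟨(hεs x (h.2.2.1.trans hδ.2)).1, (hεs y (h.2.2.2.1.trans hδ.2)).2⟩
  have hlt := hst hxy
  simp only [Set.mem_ofPred_eq] at hlt
  exact hlt h.2.2.2.2

end

/-! ### From strict differentiability to continuity of the Pansu differential. -/

section

variable {V : Type*} [LieRing V] [LieAlgebra ℝ V] [FiniteDimensional ℝ V] [TopologicalSpace V]
  [IsTopologicalAddGroup V] [ContinuousSMul ℝ V] [T2Space V] {S : Stratification V}
  {V' : Type*} [LieRing V'] [LieAlgebra ℝ V'] {S' : Stratification V'}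
  {ρ : HomogeneousDistance S} {ρ' : HomogeneousDistance S'} {Ω : Set V} {f : V → V'}

theorem isC1H_of_isStrictlyPansuDifferentiableAt (hΩ : IsOpen Ω)
    (hf : ∀ p ∈ Ω, IsStrictlyPansuDifferentiableAt ρ ρ' Ω f p) : IsC1H ρ ρ' Ω f := by
  classical
  -- The zero morphism outside `Ω` is a dummy value.
  let D : V → HomogeneousHom S S' := fun p =>
    if hp : p ∈ Ω then (hf p hp).choose else { (0 : V →ₗ⁅ℝ⁆ V') with
      map_layer := fun j v _ => (S'.layer j).zero_mem }
  have key : ∀ p ∈ Ω, ∀ η : ℝ, 0 < η → ∃ ε > 0, ∀ x ∈ Ω, ∀ y ∈ Ω, ρ.dist p x < ε →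
      ρ.dist p y < ε → x ≠ y → ρ'.dist (S'.mul (-f y) (f x))
        ((D p).toLieHom (S.mul (-y) x)) / ρ.dist x y ≤ η := by
    intro p hp η hη
    have h := (hf p hp).choose_spec
    rw [show (hf p hp).choose = D p by simp only [D, dif_pos hp], ENNReal.tendsto_nhds_zero] at h
    obtain ⟨ε, hε, hε0⟩ := ((h (ENNReal.ofReal η) (by simpa using hη)).and
      self_mem_nhdsWithin).exists
    refine ⟨ε, hε0, fun x hx y hy hpx hpy hxy => ?_⟩
    rw [← ENNReal.ofReal_le_ofReal_iff hη.le]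
    refine le_trans ?_ hε
    exact le_iSup_of_le x (le_iSup_of_le y (le_iSup_of_le ⟨hx, hy, hpx, hpy, hxy⟩ le_rfl))
  have hnear : ∀ (q : V) (ε : ℝ), 0 < ε → ∀ᶠ x in 𝓝 q, ρ.dist q x < ε := by
    intro q ε hε
    have := ρ.tendsto_dist (F := 𝓝 q) (tendsto_const_nhds (x := q)) tendsto_id
    rw [ρ.dist_self] at this
    exact this.eventually_lt_const hε
  have hdiff : ∀ p ∈ Ω, HasPansuDifferentialAt ρ ρ' Ω f (D p) p := by
    intro p hp
    rw [HasPansuDifferentialAt, Metric.tendsto_nhds]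
    intro η hη
    obtain ⟨ε, hε, h⟩ := key p hp (η / 2) (half_pos hη)
    filter_upwards [self_mem_nhdsWithin, nhdsWithin_le_nhds (hnear p ε hε)] with x hx hpx
    rw [Real.dist_eq, sub_zero, abs_of_nonneg (div_nonneg (ρ'.dist_nonneg _ _)
      (ρ.dist_nonneg _ _)), ρ.dist_comm p x]
    exact (h x hx.1 p hp hpx (by rwa [ρ.dist_self]) hx.2).trans_lt (half_lt_self hη)
  refine ⟨D, hdiff, fun p hp => ?_⟩
  rw [ENNReal.tendsto_nhds_zero]
  intro η hη
  rcases eq_or_ne η ⊤ with rfl | hη'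
  · exact Eventually.of_forall fun _ => le_top
  have hη0 : 0 < η.toReal := ENNReal.toReal_pos hη.ne' hη'
  obtain ⟨ε, hε, h⟩ := key p hp (η.toReal / 2) (half_pos hη0)
  filter_upwards [self_mem_nhdsWithin, nhdsWithin_le_nhds (hnear p ε hε)] with q hq hpq
  refine iSup₂_le fun v hv => ENNReal.ofReal_le_of_le_toReal ?_
  have hv0 : 0 < ρ.dist 0 v := ρ.dist_pos (Ne.symm hv)
  have hx : Tendsto (fun t : ℝ => S.mul q (S.dilation t v)) (𝓝[>] 0) (𝓝 q) := by
    have := S.tendsto_mul (tendsto_const_nhds (x := q) (f := 𝓝[>] (0 : ℝ)))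
      (S.tendsto_dilation nhdsWithin_le_nhds (tendsto_const_nhds (x := v)))
    rwa [S.zero_dilation, S.mul_zero] at this
  have hne : ∀ t : ℝ, 0 < t → S.mul q (S.dilation t v) ≠ q := by
    intro t ht he
    have := ρ.dist_mul_right_eq q (S.dilation t v)
    rw [he, ρ.dist_self, ρ.dist_zero_dilation ht] at this
    exact (mul_pos ht hv0).ne this
  have hxW : Tendsto (fun t : ℝ => S.mul q (S.dilation t v)) (𝓝[>] 0) (𝓝[Ω \ {q}] q) := by
    rw [tendsto_nhdsWithin_iff]
    refine ⟨hx, ?_⟩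
    filter_upwards [hx (hΩ.mem_nhds hq), self_mem_nhdsWithin] with t ht ht0
    exact ⟨ht, hne t ht0⟩
  have h1 := (Tendsto.comp (hdiff q hq) hxW).eventually_lt_const (half_pos hη0)
  have h2 : ∀ᶠ x in 𝓝 q, ρ.dist p x < ε := by
    have := ρ.tendsto_dist (F := 𝓝 q) (tendsto_const_nhds (x := p)) tendsto_id
    exact this.eventually_lt_const hpq
  -- A single small `t` suffices, by homogeneity. It may depend on `q` and `v`; only the
  -- neighbourhood of `p` must be uniform in `v`.
  obtain ⟨t, ⟨h1t, h2t⟩, hΩt, ht0⟩ := ((h1.and (hx.eventually h2)).and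
    ((hx.eventually (hΩ.mem_nhds hq)).and self_mem_nhdsWithin)).exists
  have ht0 : 0 < t := ht0
  have h3 := h _ hΩt q hq h2t hpq (hne t ht0)
  rw [Function.comp_apply, S.neg_mul_cancel_left, ρ.dist_mul_right_eq, ρ.dist_zero_dilation ht0,
    div_lt_iff₀ (mul_pos ht0 hv0)] at h1t
  rw [S.neg_mul_cancel_left, ρ.dist_comm, ρ.dist_mul_right_eq, ρ.dist_zero_dilation ht0,
    div_le_iff₀ (mul_pos ht0 hv0)] at h3
  -- The increment of `f` lies within `(η / 2) t ρ(0, v)` of both `D q (δ_t v)` and `D p (δ_t v)`.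
  have h4 := ρ'.dist_triangle ((D q).toLieHom (S.dilation t v))
    (S'.mul (-f q) (f (S.mul q (S.dilation t v)))) ((D p).toLieHom (S.dilation t v))
  rw [(D q).map_dilation, (D p).map_dilation, ρ'.dist_dilation t ht0] at h4
  rw [(D q).map_dilation, ρ'.dist_comm] at h1t
  rw [(D p).map_dilation] at h3
  rw [div_le_iff₀ hv0]
  refine le_of_mul_le_mul_left ?_ ht0
  linarith

end

end Carnot

theorem mainTheorem10
    {V : Type*} [LieRing V] [LieAlgebra ℝ V] [FiniteDimensional ℝ V]
    [TopologicalSpace V] [IsTopologicalAddGroup V] [ContinuousSMul ℝ V] [T2Space V]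
    {V' : Type*} [LieRing V'] [LieAlgebra ℝ V'] [FiniteDimensional ℝ V']
    (S : Carnot.Stratification V) (S' : Carnot.Stratification V')
    (ρ : Carnot.HomogeneousDistance S) (ρ' : Carnot.HomogeneousDistance S')
    (Ω : Set V) (hΩ : IsOpen Ω) (f : V → V') :
    Carnot.IsC1H ρ ρ' Ω f ↔
      ∀ p ∈ Ω, Carnot.IsStrictlyPansuDifferentiableAt ρ ρ' Ω f p := by
  refine ⟨fun h p hp => ?_, Carnot.isC1H_of_isStrictlyPansuDifferentiableAt hΩ⟩
  let e := (Module.finBasis ℝ V').equivFun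
  -- No topology on the target enters the statement; the proof uses the one induced by coordinates.
  let _ : TopologicalSpace V' := TopologicalSpace.induced e inferInstance
  have : IsTopologicalAddGroup V' := topologicalAddGroup_induced e
  have : ContinuousSMul ℝ V' := continuousSMul_induced e
  have : T2Space V' := T2Space.of_injective_continuous e.injective continuous_induced_dom
  exact h.isStrictlyPansuDifferentiableAt hΩ hp
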